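/- Let $k$ be a field. For an essentially small additive category $\mathcal{A}$, let $\mathcal{F}(\mathcal{A};k)$ be the category of all (not necessarily additive) functors from $\mathcal{A}$ to $k$-vector spaces, and let $\mathbf{Rep}(\mathcal{A})$ be the category of additive functors from $\mathcal{A}$ to abelian groups. Call $\mathcal{A}$ \emph{$k$-trivial} if, for all objects $x,y$ of $\mathcal{A}$, the abelian group $\mathcal{A}(x,y)$ is finite and its order is invertible in $k$. Call an abelian category \emph{locally finite} if it is generated by its objects of finite length (i.e. the objects that are both Noetherian and Artinian). If $\mathcal{A}$ is $k$-trivial, then $\mathcal{F}(\mathcal{A};k)$ is locally finite if and only if $\mathbf{Rep}(\mathcal{A})$ is locally finite. In particular, let $R$ be a $k$-trivial ring, i.e. a finite ring whose cardinality is invertible in $k$, let $\mathbf{P}(R)$ be the category of finitely generated projective left $R$-modules, and let $\mathcal{F}(R,k):=\mathcal{F}(\mathbf{P}(R);k)$. Then $\mathcal{F}(R,k)$ is locally finite. -/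

import Mathlib

open CategoryTheory Limits

universe w v u t

namespace GenericRep

/-- An object of finite length: one that is both Noetherian and Artinian. -/
def isFiniteLength (C : Type u) [Category.{v} C] : ObjectProperty C :=
  isNoetherianObject ⊓ isArtinianObject

/-- A category is locally finite if its objects of finite length generate it
(two parallel morphisms that agree after precomposition with every morphism whose source has
finite length are equal). -/
def IsLocallyFinite (C : Type u) [Category.{v} C] : Prop :=
  (isFiniteLength C).IsSeparating

/-- The category of all functors from `A` to `k`-vector spaces. -/
abbrev FunctorCat (A : Type u) [Category.{v} A] (k : Type w) [Field k] :=
  A ⥤ ModuleCat.{w} k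

/-- The category of additive functors from `A` to abelian groups. -/
abbrev Rep (A : Type u) [Category.{v} A] [Preadditive A] :=
  A ⥤+ AddCommGrpCat.{w}

/-- A category is `k`-trivial if every group of morphisms is finite, of order invertible in `k`. -/
def IsKTrivial (A : Type u) [Category.{v} A] [Preadditive A] (k : Type w) [Field k] : Prop :=
  ∀ x y : A, Finite (x ⟶ y) ∧ IsUnit (Nat.card (x ⟶ y) : k)

/-- Finitely generated projective left `R`-modules, as a property of objects of `ModuleCat R`. -/
def isFGProjective (R : Type t) [Ring R] : ObjectProperty (ModuleCat.{t} R) :=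
  fun M ↦ Module.Finite R M ∧ Module.Projective R M

/-- The category of finitely generated projective left `R`-modules. -/
abbrev ProjCat (R : Type t) [Ring R] := (isFGProjective R).FullSubcategory

/-- A ring is `k`-trivial if it is finite, of cardinality invertible in `k`. -/
def IsKTrivialRing (R : Type t) [Ring R] (k : Type w) [Field k] : Prop :=
  Finite R ∧ IsUnit (Nat.card R : k)

/-- A ring `R` is `k`-trivial if and only if its category of finitely generated projective modules
is `k`-trivial. -/
theorem isKTrivialRing_iff (R : Type t) [Ring R] (k : Type w) [Field k] :
    IsKTrivialRing R k ↔ IsKTrivial (ProjCat R) k := by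
  constructor
  · rintro ⟨hf, hu⟩ x y
    have hx : Module.Finite R x.obj := x.property.1
    have hy : Module.Finite R y.obj := y.property.1
    obtain ⟨n, f, hfs⟩ := Module.Finite.exists_fin' R x.obj
    obtain ⟨m, g, hgs⟩ := Module.Finite.exists_fin' R y.obj
    have hfy : Finite y.obj := Finite.of_surjective g hgs
    have hcy : Nat.card y.obj ∣ Nat.card R ^ m := by
      have := AddSubgroup.card_range_dvd g.toAddMonoidHom
      rw [AddMonoidHom.range_eq_top.2 hgs] at this
      simpa [Nat.card_pi] using this
    let φ : (x ⟶ y) →+ (Fin n → y.obj) :=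
      { toFun := fun h i ↦ h.hom.hom (f (Pi.single i 1))
        map_zero' := by ext i; rfl
        map_add' := fun a b ↦ by ext i; rfl }
    have hφ : Function.Injective φ := by
      intro a b hab
      apply ObjectProperty.hom_ext
      apply ModuleCat.hom_ext
      rw [← LinearMap.cancel_right hfs]
      apply LinearMap.pi_ext'
      intro i
      apply LinearMap.ext_ring
      exact congrFun hab i
    have hd : Nat.card (x ⟶ y) ∣ (Nat.card R ^ m) ^ n := by
      refine (AddSubgroup.card_dvd_of_injective φ hφ).trans ?_
      simpa [Nat.card_pi] using pow_dvd_pow_of_dvd hcy n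
    refine ⟨Finite.of_injective φ hφ, ?_⟩
    have h2 : IsUnit (((Nat.card R ^ m) ^ n : ℕ) : k) := by
      push_cast
      exact (hu.pow m).pow n
    exact isUnit_of_dvd_unit (Nat.cast_dvd_cast hd) h2
  · intro h
    let P : ProjCat R := ⟨ModuleCat.of R R, ⟨inferInstanceAs (Module.Finite R R),
      inferInstanceAs (Module.Projective R R)⟩⟩
    let e : (P ⟶ P) ≃ R :=
      ((InducedCategory.homEquiv).trans ModuleCat.homEquiv).trans
        (LinearMap.ringLmapEquivSelf R ℕ R).toEquiv
    obtain ⟨h1, h2⟩ := h P P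
    refine ⟨Finite.of_equiv _ e, ?_⟩
    rwa [← Nat.card_congr e]

end GenericRep

/-! The functor `A(x, -)` corepresents evaluation at `x` on additive functors, and its
linearization `k[A(x, -)]` does so on all functors to vector spaces. Either category is therefore
locally finite if and only if the lattices of subfunctors of these functors satisfy both chain
conditions. As `N ↦ k[N]` is strictly increasing on the subfunctors of `A(x, -)`, one implication
follows.

Conversely, if `A(x, -)` has finite length, there is an object `t` such that every `a : x ⟶ y` is
fixed by an endomorphism of `y` that is a sum of morphisms factoring through `t`. A subfunctor of
`k[A(x, -)]` is then determined by its values at the powers of `t`. Only one of these powers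
matters, by the following fact, applied to `R = End t` and `N = A(x, t)`: if `R` is a finite ring
of order invertible in `k` and `N` is a finite `R`-module, then for large `n` some element of the
two-sided ideal of `k[M_n(R)]` generated by the matrices erasing a coordinate acts as the identity
on `k[N ^ n]`. Since `k[A(x, t ^ n)]` is finite-dimensional, the chain conditions follow. For
finitely generated projective modules, `t = R` works from the start.

The fact on matrices is proved by induction on `N`: the proper submodules of `N` provide elements
of the ideal that fix the tuples which do not generate `N`, and averaging over transvections, which
uses that the order of `R` is invertible, takes care of the others. -/

namespace GenericRep

open MonoidAlgebra
open scoped Matrix.Module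

section Representation

variable {k : Type*} [CommRing k] {G G' : Type*} [Monoid G] [Monoid G']

theorem asAlgebraHom_mapDomainAlgHom {V : Type*} [AddCommGroup V] [Module k V]
    (ρ : Representation k G' V) (φ : G →* G') (X : k[G]) :
    ρ.asAlgebraHom (mapDomainAlgHom k k φ X) = Representation.asAlgebraHom (ρ.comp φ) X := by
  induction X using MonoidAlgebra.induction_on with
  | of g => simp
  | add X Y hX hY => simp only [map_add, hX, hY]
  | smul r X hX => simp only [map_smul, hX]

variable (k G) in
/-- The action of the monoid algebra `k[G]` on the free `k`-module on a `G`-set `H`. -/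
noncomputable abbrev linAct (H : Type*) [MulAction G H] : k[G] →ₐ[k] Module.End k k[H] :=
  (Representation.ofMulAction k G H).asAlgebraHom

theorem linAct_of_single {H : Type*} [MulAction G H] (g : G) (x : H) (r : k) :
    linAct k G H (of k G g) (single x r) = single (g • x) r := by
  simp

theorem linAct_ext {H : Type*} [MulAction G H] {X Y : k[G]}
    (h : ∀ x : H, linAct k G H X (single x 1) = linAct k G H Y (single x 1)) :
    linAct k G H X = linAct k G H Y := by
  ext x : 3
  simpa using! h x

theorem asAlgebraHom_apply_eq_of_linAct_eq {H : Type*} [MulAction G H] {V : Type*}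
    [AddCommGroup V] [Module k V] {ρ : Representation k G V} {f : H → V}
    (hf : ∀ g x, f (g • x) = ρ g (f x)) {X : k[G]} {x : H}
    (hX : linAct k G H X (single x 1) = single x 1) : ρ.asAlgebraHom X (f x) = f x := by
  let e : k[H] →ₗ[k] V := Finsupp.linearCombination k f ∘ₗ (coeffLinearEquiv k).toLinearMap
  have he (y : H) : e (single y 1) = f y := by simp [e]
  have key (Y : k[G]) : ρ.asAlgebraHom Y (f x) = e (linAct k G H Y (single x 1)) := by
    induction Y using MonoidAlgebra.induction_on with
    | of g => rw [linAct_of_single, he, hf, Representation.asAlgebraHom_of]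
    | add Y Z hY hZ => simp only [map_add, LinearMap.add_apply, hY, hZ]
    | smul r Y hY => simp only [map_smul, LinearMap.smul_apply, hY]
  rw [key, hX, he]

end Representation

section TwoSidedIdeal

/-- If `1` is congruent to an element of `I` modulo `J` and to another modulo `K`, then it is
congruent to one modulo both: `1 - (x + y - x * y) = (1 - x) * (1 - y)`. -/
theorem exists_mem_forall_one_sub_mem {A : Type*} [Ring A] {I : TwoSidedIdeal A} {κ : Type*}
    [Finite κ] {K : κ → TwoSidedIdeal A} (h : ∀ i, ∃ x ∈ I, 1 - x ∈ K i) :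
    ∃ x ∈ I, ∀ i, 1 - x ∈ K i := by
  classical
  have := Fintype.ofFinite κ
  suffices ∀ s : Finset κ, ∃ x ∈ I, ∀ i ∈ s, 1 - x ∈ K i by
    simpa using this Finset.univ
  intro s
  induction s using Finset.induction_on with
  | empty => exact ⟨0, I.zero_mem, by simp⟩
  | insert j s _ ih =>
    obtain ⟨x, hxI, hx⟩ := ih
    obtain ⟨y, hyI, hy⟩ := h j
    have hxy : 1 - (x + y - x * y) = (1 - x) * (1 - y) := by noncomm_ring
    refine ⟨x + y - x * y, I.sub_mem (I.add_mem hxI hyI) (I.mul_mem_left _ _ hyI),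
      fun i hi ↦ hxy ▸ ?_⟩
    obtain rfl | hi := Finset.mem_insert.1 hi
    · exact (K i).mul_mem_left _ _ hy
    · exact (K i).mul_mem_right _ _ (hx i hi)

end TwoSidedIdeal

section Matrices

variable {R : Type*} [Ring R] {N : Type*} [AddCommGroup N] [Module R N]
  {ι : Type*} [Fintype ι] [DecidableEq ι]

variable (R) in
/-- The diagonal matrix that erases the coordinate `j`. -/
def eraseCoord (j : ι) : Matrix ι ι R := Matrix.diagonal (Function.update 1 j 0)

theorem eraseCoord_smul (j : ι) (m : ι → N) : eraseCoord R j • m = Function.update m j 0 := by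
  ext i
  rw [Matrix.Module.smul_apply,
    Finset.sum_eq_single i (fun l _ hl ↦ by simp [eraseCoord, hl.symm]) (by simp)]
  obtain rfl | h := eq_or_ne i j <;> simp [eraseCoord, *]

/-- The transvection of `N ^ ι` adding to the coordinate `t` the linear combination of the
coordinates with coefficients `α`. -/
def addRow (t : ι) (α : ι → R) : Matrix ι ι R := 1 + Matrix.vecMulVec (Pi.single t 1) α

theorem addRow_smul (t : ι) (α : ι → R) (m : ι → N) :
    addRow t α • m = Function.update m t (m t + Fintype.linearCombination R m α) := by
  ext i
  rw [addRow, add_smul, one_smul, Pi.add_apply, Matrix.Module.smul_apply]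
  obtain rfl | h := eq_or_ne i t <;>
    simp [Matrix.vecMulVec_apply, Fintype.linearCombination_apply, *]

theorem addRow_mul_addRow {t : ι} {α : ι → R} (hα : α t = 0) (β : ι → R) :
    addRow t α * addRow t β = addRow t (α + β) := by
  simp [addRow, mul_add, add_mul, Matrix.vecMulVec_mul_vecMulVec, hα, Matrix.vecMulVec_add,
    add_assoc]

/-- Extension by the identity of a matrix with indices in `T`. -/
def extendMatrix (T : Finset ι) : Matrix T T R →* Matrix ι ι R where
  toFun a := (Matrix.fromBlocks a 0 0 (1 : Matrix {i // i ∉ T} {i // i ∉ T} R)).submatrix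
    (Equiv.sumCompl (· ∈ T)).symm (Equiv.sumCompl (· ∈ T)).symm
  map_one' := by
    rw [Matrix.fromBlocks_one, Matrix.submatrix_one_equiv]
  map_mul' a b := by
    rw [Matrix.submatrix_mul_equiv, Matrix.fromBlocks_multiply]
    simp

theorem extendMatrix_smul (T : Finset ι) (a : Matrix T T R) (m : ι → N) (i : ι) :
    (extendMatrix T a • m) i = if h : i ∈ T then (a • fun l : T ↦ m l) ⟨i, h⟩ else m i := by
  rw [Matrix.Module.smul_apply, ← (Equiv.sumCompl (· ∈ T)).sum_comp, Fintype.sum_sum_type]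
  by_cases h : i ∈ T
  · simp [extendMatrix, h, Equiv.sumCompl_symm_apply_of_pos, Matrix.Module.smul_apply]
  · simp [extendMatrix, h, Equiv.sumCompl_symm_apply_of_neg, Matrix.one_apply]

theorem extendMatrix_eraseCoord (T : Finset ι) (j : T) :
    extendMatrix T (eraseCoord R j) = eraseCoord R (j : ι) := by
  refine Matrix.ext_of_mulVec_single fun l ↦ ?_
  change extendMatrix T (eraseCoord R j) • (Pi.single l 1 : ι → R) = eraseCoord R (j : ι) • _
  ext i
  rw [extendMatrix_smul, eraseCoord_smul, eraseCoord_smul]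
  by_cases h : i ∈ T
  · simp [h, Function.update_apply, Subtype.ext_iff]
  · rw [dif_neg h, Function.update_of_ne (by rintro rfl; exact h j.2)]

end Matrices

section Averages

variable {k : Type*} [CommRing k] {R : Type*} [Ring R]

theorem isUnit_natCard_submodule (hR : IsUnit (Nat.card R : k)) {ι : Type*} [Finite ι]
    (W : Submodule R (ι → R)) : IsUnit (Nat.card W : k) := by
  have := Fintype.ofFinite ι
  have hdvd : Nat.card W ∣ Nat.card R ^ Fintype.card ι := by
    simpa [Nat.card_pi] using W.toAddSubgroup.card_addSubgroup_dvd_card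
  exact isUnit_of_dvd_unit (Nat.cast_dvd_cast hdvd) (by simpa using hR.pow _)

variable {N : Type*} [AddCommGroup N] [Module R N] {ι : Type*} [Fintype ι] [DecidableEq ι]

variable (k) in
/-- The average of the transvections adding to the coordinate `t` a linear combination of the
coordinates with coefficients in `W`; it is meant for the case where `Nat.card W` is invertible in
`k`, and is `0` otherwise. -/
noncomputable def avg (t : ι) (W : Submodule R (ι → R)) : k[Matrix ι ι R] :=
  Ring.inverse (Nat.card W : k) • ∑ᶠ α : W, of k _ (addRow t α)

variable [Finite R]

theorem avg_mul_of_addRow {t : ι} {W : Submodule R (ι → R)} (hW : ∀ α ∈ W, α t = 0) {β : ι → R}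
    (hβ : β ∈ W) : avg k t W * of k _ (addRow t β) = avg k t W := by
  simp only [avg, smul_mul_assoc, finsum_mul' _ _ (Set.toFinite _), ← map_mul,
    addRow_mul_addRow (hW _ (Subtype.coe_prop _))]
  congr 1
  exact finsum_comp_equiv (f := fun α : W ↦ of k _ (addRow t (α : ι → R)))
    (Equiv.addRight ⟨β, hβ⟩)

theorem map_avg_eq (hR : IsUnit (Nat.card R : k)) {t : ι} {W : Submodule R (ι → R)} {V : Type*}
    [AddCommGroup V] [Module k V] (f : k[Matrix ι ι R] →ₗ[k] V) {v : V}
    (hf : ∀ α ∈ W, f (of k _ (addRow t α)) = v) : f (avg k t W) = v := by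
  have := Fintype.ofFinite W
  rw [avg, map_smul, finsum_eq_sum_of_fintype, map_sum,
    Finset.sum_congr rfl fun (α : W) _ ↦ hf α α.2, Finset.sum_const, Finset.card_univ,
    ← Nat.card_eq_fintype_card, ← Nat.cast_smul_eq_nsmul k, smul_smul,
    Ring.inverse_mul_cancel _ (isUnit_natCard_submodule hR W), one_smul]

theorem map_linAct_avg_single_eq (hR : IsUnit (Nat.card R : k)) {t : ι}
    {W : Submodule R (ι → R)} {m : ι → N} {V : Type*} [AddCommGroup V] [Module k V]
    (f : k[ι → N] →ₗ[k] V) {v : V}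
    (hf : ∀ α ∈ W,
      f (single (Function.update m t (m t + Fintype.linearCombination R m α)) 1) = v) :
    f (linAct k _ _ (avg k t W) (single m 1)) = v := by
  refine map_avg_eq hR
    (f ∘ₗ LinearMap.applyₗ (single m 1) ∘ₗ (linAct k _ (ι → N)).toLinearMap) fun α hα ↦ ?_
  rw [← hf α hα, ← addRow_smul, ← linAct_of_single]
  rfl

theorem linAct_mul_avg_single_update (hR : IsUnit (Nat.card R : k)) {B : k[Matrix ι ι R]} {t : ι}
    (W : Submodule R (ι → R)) {m : ι → N}
    (hB : ∀ x, linAct k _ _ B (single (Function.update m t x) 1) = 0) (x : N) :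
    linAct k _ _ (B * avg k t W) (single (Function.update m t x) 1) = 0 := by
  rw [map_mul, Module.End.mul_apply]
  refine map_linAct_avg_single_eq hR _ fun α _ ↦ ?_
  rw [Function.update_idem, hB]

theorem linAct_avg_single_update {t : ι} {W : Submodule R (ι → R)} (hW : ∀ α ∈ W, α t = 0)
    {β : ι → R} (hβ : β ∈ W) (m : ι → N) :
    linAct k _ _ (avg k t W)
        (single (Function.update m t (m t + Fintype.linearCombination R m β)) 1) =
      linAct k _ _ (avg k t W) (single m 1) := by
  rw [← addRow_smul, ← linAct_of_single, ← Module.End.mul_apply, ← map_mul,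
    avg_mul_of_addRow hW hβ]

end Averages

section ErasureIdeal

/-- The two-sided ideal of the monoid algebra of square matrices generated by the matrices erasing
one coordinate. -/
noncomputable def erasureIdeal (k : Type*) [CommRing k] (R : Type*) [Ring R] (ι : Type*) [Fintype ι]
    [DecidableEq ι] : TwoSidedIdeal k[Matrix ι ι R] :=
  .span (Set.range fun j ↦ of k _ (eraseCoord R j))

variable {k : Type*} [CommRing k] {R : Type*} [Ring R] {N : Type*} [AddCommGroup N] [Module R N]
  {ι : Type*} [Fintype ι] [DecidableEq ι] {Q : Type*} [Ring Q] {q : k[Matrix ι ι R] →+* Q}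

theorem map_eq_zero_of_mem_erasureIdeal (hq : ∀ j, q (of k _ (eraseCoord R j)) = 0)
    {X : k[Matrix ι ι R]} (hX : X ∈ erasureIdeal k R ι) : q X = 0 := by
  have hle : erasureIdeal k R ι ≤ TwoSidedIdeal.ker q := by
    rw [erasureIdeal, TwoSidedIdeal.span_le]
    rintro _ ⟨j, rfl⟩
    exact (TwoSidedIdeal.mem_ker _).2 (hq j)
  exact (TwoSidedIdeal.mem_ker _).1 (hle hX)

/-- `Y` changes coordinates by `u`, acts by `X` on the coordinates in `T`, then changes back. -/
theorem exists_map_eq_zero_and_forall_linAct_eq (hq : ∀ j, q (of k _ (eraseCoord R j)) = 0)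
    {T : Finset ι} {X : k[Matrix T T R]} (hX : X ∈ erasureIdeal k R T)
    (hXfix : ∀ m : T → N, Submodule.span R (Set.range m) ≠ ⊤ →
      linAct k _ _ X (single m 1) = single m 1)
    {u u' : Matrix ι ι R} (hu : u' * u = 1) {W : Submodule R (ι → R)} (hW : ∀ i ∈ T, u i ∈ W) :
    ∃ Y : k[Matrix ι ι R], q Y = 0 ∧ ∀ m : ι → N, W.map (Fintype.linearCombination R m) ≠ ⊤ →
      linAct k _ _ Y (single m 1) = single m 1 := by
  let ext : k[Matrix T T R] →ₐ[k] k[Matrix ι ι R] := mapDomainAlgHom k k (extendMatrix T)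
  have hqX : (q.comp (ext : k[Matrix T T R] →+* _)) X = 0 :=
    map_eq_zero_of_mem_erasureIdeal (fun j ↦ by simpa [ext, extendMatrix_eraseCoord] using hq j) hX
  refine ⟨of k _ u' * ext X * of k _ u, by simp [show q (ext X) = 0 from hqX], fun m hm ↦ ?_⟩
  have hspan : Submodule.span R (Set.range fun i : T ↦ (u • m) i) ≠ ⊤ := by
    refine ne_top_of_le_ne_top hm (Submodule.span_le.2 ?_)
    rintro _ ⟨i, rfl⟩
    exact ⟨u i, hW i i.2, rfl⟩
  have hext : linAct k _ _ (ext X) (single (u • m) 1) = single (u • m) 1 := by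
    let f (x : T → N) : k[ι → N] :=
      single (fun i ↦ if h : i ∈ T then x ⟨i, h⟩ else (u • m) i) 1
    have hf : f (fun i ↦ (u • m) i) = single (u • m) 1 := by simp only [f, dite_eq_ite, ite_self]
    rw [← hf, asAlgebraHom_mapDomainAlgHom]
    refine asAlgebraHom_apply_eq_of_linAct_eq (fun a x ↦ ?_) (hXfix _ hspan)
    rw [MonoidHom.comp_apply, Representation.ofMulAction_single]
    refine congrArg (single · 1) (funext fun i ↦ ?_)
    rw [extendMatrix_smul]
    by_cases h : i ∈ T <;> simp [h]
  rw [map_mul, map_mul, Module.End.mul_apply, Module.End.mul_apply, linAct_of_single, hext,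
    linAct_of_single, ← mul_smul, hu, one_smul]

theorem linearCombination_update {t : ι} {α : ι → R} (hα : α t = 0) (m : ι → N) (x : N) :
    Fintype.linearCombination R (Function.update m t x) α = Fintype.linearCombination R m α := by
  refine Finset.sum_congr rfl fun i _ ↦ ?_
  obtain rfl | h := eq_or_ne i t <;> simp [*]

theorem map_linearCombination_update {t : ι} {W : Submodule R (ι → R)} (hW : ∀ α ∈ W, α t = 0)
    (m : ι → N) (x : N) : W.map (Fintype.linearCombination R (Function.update m t x)) =
      W.map (Fintype.linearCombination R m) :=
  SetLike.ext fun _ ↦ exists_congr fun _ ↦ and_congr_right fun hα ↦ by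
    rw [linearCombination_update (hW _ hα)]

variable [Finite R]

theorem map_avg_mul_map_one_sub_avg (hR : IsUnit (Nat.card R : k))
    (hρ : ∀ X, linAct k _ (ι → N) X = 0 → q X = 0) {t : ι} {W K : Submodule R (ι → R)}
    (hK : ∀ α ∈ K, α t = 0) (hWK : W ≤ K) {Y : k[Matrix ι ι R]} (hY : q Y = 0)
    (hYfix : ∀ m : ι → N, W.map (Fintype.linearCombination R m) ≠ ⊤ →
      linAct k _ _ Y (single m 1) = single m 1) :
    q (avg k t W) * q (1 - avg k t K) = 0 := by
  have hW (α) (hα : α ∈ W) : α t = 0 := hK α (hWK hα)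
  have key : linAct k _ (ι → N) ((1 - Y) * (avg k t W * (1 - avg k t K))) = 0 := by
    refine (linAct_ext fun m ↦ ?_).trans (map_zero _)
    rw [map_zero, LinearMap.zero_apply]
    by_cases hm : W.map (Fintype.linearCombination R m) = ⊤
    · have hfix : linAct k _ _ (avg k t W * avg k t K) (single m 1) =
          linAct k _ _ (avg k t W) (single m 1) := by
        rw [map_mul, Module.End.mul_apply]
        refine map_linAct_avg_single_eq hR _ fun β _ ↦ ?_
        obtain ⟨α, hα, hαβ⟩ : Fintype.linearCombination R m β ∈
          W.map (Fintype.linearCombination R m) := hm ▸ Submodule.mem_top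
        rw [← hαβ, linAct_avg_single_update hW hα]
      rw [map_mul, Module.End.mul_apply, mul_sub, mul_one, map_sub (linAct k _ _) (avg k t W),
        LinearMap.sub_apply, hfix, sub_self, map_zero]
    · have hB (x : N) : linAct k _ _ (1 - Y) (single (Function.update m t x) 1) = 0 := by
        rw [map_sub, map_one, LinearMap.sub_apply, Module.End.one_apply, hYfix, sub_self]
        rwa [map_linearCombination_update hW]
      have hBW := linAct_mul_avg_single_update hR W hB
      have hBWK := linAct_mul_avg_single_update hR K hBW
      rw [← Function.update_eq_self t m, ← mul_assoc, mul_sub, mul_one, map_sub,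
        LinearMap.sub_apply, hBW, hBWK, sub_self]
  simpa [hY] using hρ _ key

end ErasureIdeal

section FiniteModules

theorem exists_finset_forall_exists_notMem_map_eq {ι β : Type*} [Fintype ι] [Finite β] (m : ι → β)
    (t : ι) {n : ℕ} (hn : n + Nat.card β + 1 ≤ Fintype.card ι) :
    ∃ T : Finset ι, n ≤ T.card ∧ t ∉ T ∧ ∀ i ∈ T, ∃ r ∉ T, r ≠ t ∧ m r = m i := by
  classical
  have := Fintype.ofFinite β
  obtain ⟨S, hSt, hSinj, hSm⟩ := Finset.exists_subset_injOn_image_eq_of_surjOn {i | i ≠ t}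
    ((Finset.univ.erase t).image m) (f := m) (fun x hx ↦ by simpa using hx)
  have hS : S.card ≤ Nat.card β := by
    rw [← Finset.card_image_of_injOn hSinj, Nat.card_eq_fintype_card]
    exact Finset.card_le_univ _
  refine ⟨(insert t S)ᶜ, ?_, by simp, fun i hi ↦ ?_⟩
  · have := Finset.card_insert_le t S
    rw [Finset.card_compl]
    lia
  · have hit : i ≠ t := fun h ↦ by simp [h] at hi
    obtain ⟨r, hrS, hr⟩ := Finset.mem_image.1
      (hSm ▸ Finset.mem_image_of_mem m (Finset.mem_erase.2 ⟨hit, Finset.mem_univ i⟩))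
    exact ⟨r, by simp [hrS], hSt hrS, hr⟩

variable {k : Type*} [CommRing k] {R : Type*} [Ring R] {N : Type*} [AddCommGroup N] [Module R N]
  [Finite N] {ι : Type*} [Fintype ι] [DecidableEq ι]

variable (R) in
/-- The row vectors that vanish at `t`. -/
def vanishingAt (t : ι) : Submodule R (ι → R) := LinearMap.ker (LinearMap.proj t)

/-- A tuple with many more entries than there are values has many repeated entries, which become
zero when the entries that they repeat are subtracted from them. -/
theorem exists_rows_mem_ker_linearCombination (m : ι → N) (t : ι) {n : ℕ}
    (hn : n + Nat.card N + 1 ≤ Fintype.card ι) :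
    ∃ (T : Finset ι) (u u' : Matrix ι ι R), n ≤ T.card ∧ u' * u = 1 ∧
      ∀ i ∈ T, u i ∈ vanishingAt R t ⊓ LinearMap.ker (Fintype.linearCombination R m) := by
  obtain ⟨T, hnT, htT, hT⟩ := exists_finset_forall_exists_notMem_map_eq m t hn
  choose! r hrT hrt hrm using hT
  let P : Matrix ι ι R := fun i ↦ if i ∈ T then Pi.single (r i) 1 else 0
  have hPP : P * P = 0 := by
    ext i j
    refine Finset.sum_eq_zero fun l _ ↦ ?_
    by_cases hi : i ∈ T
    · obtain rfl | hl := eq_or_ne l (r i)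
      · simp [P, hrT i hi]
      · simp [P, hi, hl]
    · simp [P, hi]
  have hrow (i : ι) (hi : i ∈ T) : (1 - P) i = Pi.single i 1 - Pi.single (r i) 1 := by
    ext j
    change (1 : Matrix ι ι R) i j - P i j = _
    simp [P, hi, Matrix.one_apply, Pi.single_apply, eq_comm]
  refine ⟨T, 1 - P, 1 + P, hnT, by simp [mul_sub, add_mul, hPP], fun i hi ↦ ⟨?_, ?_⟩⟩
  · have hit : t ≠ i := fun h ↦ htT (h ▸ hi)
    simp [hrow i hi, vanishingAt, hit, (hrt i hi).symm]
  · simp [hrow i hi, hrm i hi]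

theorem exists_mem_erasureIdeal_forall_linAct_single_eq {T : Type*} [Fintype T] [DecidableEq T]
    (h : ∀ p : Submodule R N, p ≠ ⊤ →
      ∃ X ∈ erasureIdeal k R T, linAct k _ (T → p) X = 1) :
    ∃ X ∈ erasureIdeal k R T, ∀ m : T → N, Submodule.span R (Set.range m) ≠ ⊤ →
      linAct k _ _ X (single m 1) = single m 1 := by
  obtain ⟨X, hX, hXp⟩ := exists_mem_forall_one_sub_mem (I := erasureIdeal k R T)
    (K := fun p : {p : Submodule R N // p ≠ ⊤} ↦
      TwoSidedIdeal.ker (linAct k (Matrix T T R) (T → p.1)).toRingHom) fun p ↦ by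
    obtain ⟨X, hX, hXp⟩ := h p p.2
    refine ⟨X, hX, (TwoSidedIdeal.mem_ker _).2 ?_⟩
    change linAct k (Matrix T T R) (T → p.1) (1 - X) = 0
    rw [map_sub, map_one, hXp, sub_self]
  refine ⟨X, hX, fun m hm ↦ ?_⟩
  have hXp : linAct k (Matrix T T R) (T → Submodule.span R (Set.range m)) (1 - X) = 0 :=
    (TwoSidedIdeal.mem_ker _).1 (hXp ⟨_, hm⟩)
  rw [map_sub, map_one, sub_eq_zero] at hXp
  refine asAlgebraHom_apply_eq_of_linAct_eq
    (ρ := Representation.ofMulAction k (Matrix T T R) (T → N))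
    (f := fun x : T → Submodule.span R (Set.range m) ↦ single (fun i ↦ (x i : N)) 1)
    (x := fun i ↦ ⟨m i, Submodule.subset_span ⟨i, rfl⟩⟩) (fun a x ↦ ?_)
    (by rw [← hXp, Module.End.one_apply])
  rw [Representation.ofMulAction_single]
  congr 1
  ext i
  simp [Matrix.Module.smul_apply]

variable [Finite R] {Q : Type*} [Ring Q] {q : k[Matrix ι ι R] →+* Q}

/-- Each factor of the product of the elements `1 - avg k t (W m)`, taken over all tuples `m`,
kills the tuple `m`, so the product acts as zero; each of these factors acts as `1` on
`q (1 - avg k t K)`. -/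
theorem map_avg_eq_one (hR : IsUnit (Nat.card R : k))
    (hρ : ∀ X, linAct k _ (ι → N) X = 0 → q X = 0) {t : ι} {K : Submodule R (ι → R)}
    {W : (ι → N) → Submodule R (ι → R)} (hWt : ∀ m, ∀ α ∈ W m, α t = 0)
    (hWm : ∀ m, ∀ α ∈ W m, Fintype.linearCombination R m α = 0)
    (hWK : ∀ m, q (avg k t (W m)) * q (1 - avg k t K) = 0) : q (avg k t K) = 1 := by
  classical
  have := Fintype.ofFinite N
  have key (s : Finset (ι → N)) : ∃ B : k[Matrix ι ι R], q B * q (1 - avg k t K) =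
      q (1 - avg k t K) ∧
      ∀ m ∈ s, ∀ x, linAct k _ _ B (single (Function.update m t x) 1) = 0 := by
    induction s using Finset.induction_on with
    | empty => exact ⟨1, by simp, by simp⟩
    | insert m s _ ih =>
      obtain ⟨B, hqB, hB⟩ := ih
      refine ⟨B * (1 - avg k t (W m)), ?_, fun m' hm' x ↦ ?_⟩
      · rw [map_mul, mul_assoc, map_sub q 1 (avg k t (W m)), map_one, sub_mul, one_mul, hWK,
          sub_zero, hqB]
      · rw [mul_sub, mul_one, map_sub, LinearMap.sub_apply, sub_eq_zero, eq_comm]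
        obtain rfl | hm' := Finset.mem_insert.1 hm'
        · rw [map_mul, Module.End.mul_apply]
          refine map_linAct_avg_single_eq hR _ fun α hα ↦ ?_
          rw [linearCombination_update (hWt _ α hα), hWm _ α hα, add_zero, Function.update_eq_self]
        · rw [linAct_mul_avg_single_update hR _ (hB m' hm'), hB m' hm']
  obtain ⟨B, hqB, hB⟩ := key Finset.univ
  have hB0 : linAct k _ (ι → N) B = 0 := by
    refine (linAct_ext fun m ↦ ?_).trans (map_zero _)
    simpa using hB m (Finset.mem_univ m) (m t)
  rw [hρ B hB0, zero_mul, eq_comm, map_sub, map_one, sub_eq_zero] at hqB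
  exact hqB.symm

/-- A tuple with more entries than there are values has two equal entries `m j = m l`. The tuples
`m` and `Function.update m j 0` then have the same image under the average over all combinations
added to the coordinate `j`, so the product over all `j` of this average times the element
`1 - eraseCoord R j` acts as zero. -/
theorem one_eq_zero_of_map_avg_eq_one (hR : IsUnit (Nat.card R : k))
    (hρ : ∀ X, linAct k _ (ι → N) X = 0 → q X = 0)
    (hq : ∀ j, q (of k _ (eraseCoord R j)) = 0)
    (havg : ∀ j, q (avg k j (vanishingAt R j)) = 1) (hN : Nat.card N < Fintype.card ι) :
    (1 : Q) = 0 := by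
  have key (s : Finset ι) : ∃ B : k[Matrix ι ι R], q B = 1 ∧
      ∀ m : ι → N, (∃ j ∈ s, ∃ l, j ≠ l ∧ m j = m l) → linAct k _ _ B (single m 1) = 0 := by
    induction s using Finset.induction_on with
    | empty => exact ⟨1, by simp, by simp⟩
    | insert j s hj ih =>
      obtain ⟨B, hqB, hB⟩ := ih
      refine ⟨B * avg k j (vanishingAt R j) * (1 - of k _ (eraseCoord R j)),
        by rw [map_mul, map_mul, hqB, havg, map_sub, hq, map_one, sub_zero, one_mul, one_mul],
        fun m hm ↦ ?_⟩
      rw [map_mul, Module.End.mul_apply, map_sub (linAct k _ _) 1, map_one, LinearMap.sub_apply,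
        linAct_of_single, eraseCoord_smul, Module.End.one_apply, map_sub]
      by_cases hjl : ∃ l, j ≠ l ∧ m j = m l
      · obtain ⟨l, hl, hml⟩ := hjl
        have hα : -Pi.single l 1 ∈ vanishingAt R j := by simp [vanishingAt, hl]
        have : m j + Fintype.linearCombination R m (-Pi.single l 1) = 0 := by
          simp [hml]
        rw [← this, map_mul, Module.End.mul_apply, Module.End.mul_apply,
          linAct_avg_single_update (fun α hα ↦ hα) hα, sub_self]
      · obtain ⟨i, hi, l, hil, hml⟩ := hm
        have hi : i ∈ s := Finset.mem_of_mem_insert_of_ne hi fun h ↦ hjl ⟨l, h ▸ hil, h ▸ hml⟩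
        have hij : i ≠ j := fun h ↦ hj (h ▸ hi)
        have hlj : l ≠ j := fun h ↦ hjl ⟨i, hij.symm, h ▸ hml.symm⟩
        have hBx := linAct_mul_avg_single_update hR (vanishingAt R j) (m := m) fun x ↦
          hB (Function.update m j x) ⟨i, hi, l, hil, by simp [hij, hlj, hml]⟩
        rw [hBx, sub_zero, ← Function.update_eq_self j m, hBx]
  obtain ⟨B, hqB, hB⟩ := key Finset.univ
  rw [← hqB]
  refine hρ B ((linAct_ext fun m ↦ ?_).trans (map_zero _))
  have hm : ¬ Function.Injective m := fun hm ↦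
    hN.not_ge (Nat.card_eq_fintype_card (α := ι) ▸ Nat.card_le_card_of_injective m hm)
  obtain ⟨j, l, hml, hjl⟩ := Function.not_injective_iff.1 hm
  rw [hB m ⟨j, Finset.mem_univ j, l, hjl, hml⟩, map_zero, LinearMap.zero_apply]

theorem exists_mem_erasureIdeal_linAct_eq_one_of_forall_span_ne_top (hR : IsUnit (Nat.card R : k))
    {n : ℕ} (hn : n + Nat.card N + 1 ≤ Fintype.card ι)
    (hT : ∀ T : Finset ι, n ≤ T.card → ∃ X ∈ erasureIdeal k R T, ∀ m : T → N,
      Submodule.span R (Set.range m) ≠ ⊤ → linAct k _ _ X (single m 1) = single m 1) :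
    ∃ X ∈ erasureIdeal k R ι, linAct k _ (ι → N) X = 1 := by
  let ρ : k[Matrix ι ι R] →+* Module.End k k[ι → N] := (linAct k (Matrix ι ι R) (ι → N)).toRingHom
  let J := erasureIdeal k R ι ⊔ TwoSidedIdeal.ker ρ
  let q := J.ringCon.mk'
  have mem_J {X} : q X = 0 ↔ X ∈ J := by
    rw [← TwoSidedIdeal.mem_ker, TwoSidedIdeal.ker_ringCon_mk']
  have hq (j : ι) : q (of k _ (eraseCoord R j)) = 0 :=
    mem_J.2 (TwoSidedIdeal.mem_sup_left (TwoSidedIdeal.subset_span ⟨j, rfl⟩))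
  have hρ (X) (hX : linAct k _ (ι → N) X = 0) : q X = 0 :=
    mem_J.2 (TwoSidedIdeal.mem_sup_right ((TwoSidedIdeal.mem_ker ρ).2 hX))
  have havg (j : ι) : q (avg k j (vanishingAt R j)) = 1 := by
    refine map_avg_eq_one hR hρ
      (W := fun m ↦ vanishingAt R j ⊓ LinearMap.ker (Fintype.linearCombination R m))
      (fun m α hα ↦ hα.1) (fun m α hα ↦ hα.2) fun m ↦ ?_
    obtain ⟨T, u, u', hnT, hu, huW⟩ := exists_rows_mem_ker_linearCombination (R := R) m j hn
    obtain ⟨X, hX, hXfix⟩ := hT T hnT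
    obtain ⟨Y, hY, hYfix⟩ := exists_map_eq_zero_and_forall_linAct_eq hq hX hXfix hu huW
    exact map_avg_mul_map_one_sub_avg hR hρ (fun α hα ↦ hα) inf_le_left hY hYfix
  have hone : (1 : k[Matrix ι ι R]) ∈ J :=
    mem_J.1 ((map_one q).trans (one_eq_zero_of_map_avg_eq_one hR hρ hq havg (by omega)))
  obtain ⟨X, hX, Z, hZ, hXZ⟩ := TwoSidedIdeal.mem_sup.1 hone
  refine ⟨X, hX, ?_⟩
  have hZ : linAct k _ (ι → N) Z = 0 := (TwoSidedIdeal.mem_ker ρ).1 hZ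
  rw [← map_one (linAct k (Matrix ι ι R) (ι → N)), ← hXZ, map_add, hZ, add_zero]

theorem exists_forall_exists_mem_erasureIdeal_linAct_eq_one (hR : IsUnit (Nat.card R : k))
    (N : Type*) [AddCommGroup N] [Module R N] [Finite N] :
    ∃ n : ℕ, ∀ (ι : Type*) [Fintype ι] [DecidableEq ι], n ≤ Fintype.card ι →
      ∃ X ∈ erasureIdeal k R ι, linAct k _ (ι → N) X = 1 := by
  induction hc : Nat.card N using Nat.strong_induction_on generalizing N with
  | _ c ih =>
    have hp (p : {p : Submodule R N // p ≠ ⊤}) := ih (Nat.card p.1)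
      (hc ▸ Set.ncard_lt_card fun h ↦ p.2 (SetLike.coe_injective h)) p.1 rfl
    choose n hn using hp
    have := Fintype.ofFinite {p : Submodule R N // p ≠ ⊤}
    refine ⟨Finset.univ.sup n + Nat.card N + 1, fun ι _ _ hι ↦
      exists_mem_erasureIdeal_linAct_eq_one_of_forall_span_ne_top hR hι fun T hT ↦
        exists_mem_erasureIdeal_forall_linAct_single_eq fun p hp ↦ hn ⟨p, hp⟩ T ?_⟩
    rw [Fintype.card_coe]
    exact (Finset.le_sup (Finset.mem_univ _)).trans hT

end FiniteModules

section ChainConditions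

/-- The ascending and the descending chain conditions. -/
structure HasChainConditions (α : Type*) [Preorder α] : Prop where
  wellFoundedLT : WellFoundedLT α
  wellFoundedGT : WellFoundedGT α

theorem HasChainConditions.of_strictMono {α β : Type*} [Preorder α] [Preorder β]
    (hβ : HasChainConditions β) {f : α → β} (hf : StrictMono f) : HasChainConditions α :=
  have := hβ.wellFoundedLT
  have := hβ.wellFoundedGT
  ⟨hf.wellFoundedLT, hf.wellFoundedGT⟩

theorem HasChainConditions.prod {α β : Type*} [PartialOrder α] [PartialOrder β]
    (hα : HasChainConditions α) (hβ : HasChainConditions β) : HasChainConditions (α × β) :=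
  have := hα.wellFoundedLT
  have := hα.wellFoundedGT
  have := hβ.wellFoundedLT
  have := hβ.wellFoundedGT
  ⟨inferInstance, inferInstance⟩

/-- An element of finite height: both chain conditions hold below it. -/
def IsFiniteHeight {α : Type*} [Preorder α] (a : α) : Prop := HasChainConditions (Set.Iic a)

theorem IsFiniteHeight.hasChainConditions {α : Type*} [Preorder α] {a : α} (ha : IsFiniteHeight a)
    (h : ∀ b, b ≤ a) : HasChainConditions α :=
  HasChainConditions.of_strictMono ha (f := fun b ↦ ⟨b, h b⟩) fun _ _ hlt ↦ hlt

/-- An element `z ≤ a ⊔ b` is determined, among those comparable to it, by `z ⊓ a` and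
`(z ⊔ a) ⊓ b`. -/
theorem IsFiniteHeight.sup {α : Type*} [Lattice α] [IsModularLattice α] {a b : α}
    (ha : IsFiniteHeight a) (hb : IsFiniteHeight b) : IsFiniteHeight (a ⊔ b) := by
  let φ : Set.Iic (a ⊔ b) → Set.Iic a × Set.Iic b := fun z ↦
    (⟨z ⊓ a, inf_le_right⟩, ⟨(z ⊔ a) ⊓ b, inf_le_right⟩)
  refine (HasChainConditions.prod ha hb).of_strictMono (f := φ) fun z z' hlt ↦ ?_
  have h : (z : α) ≤ z' := hlt.le
  have hle : φ z ≤ φ z' := ⟨inf_le_inf_right a h, inf_le_inf_right b (sup_le_sup_right h a)⟩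
  refine lt_of_le_not_ge hle fun ⟨(hinf : (z' : α) ⊓ a ≤ (z : α) ⊓ a),
    (hinf' : ((z' : α) ⊔ a) ⊓ b ≤ ((z : α) ⊔ a) ⊓ b)⟩ ↦ hlt.ne (Subtype.ext ?_)
  have hab : a ⊔ b ≤ (z : α) ⊔ a ⊔ b := sup_le_sup_right le_sup_right b
  have hsup : (z : α) ⊔ a = (z' : α) ⊔ a :=
    eq_of_le_of_inf_le_of_sup_le (sup_le_sup_right h a) hinf'
      ((sup_le (sup_le z'.2 le_sup_left) le_sup_right).trans hab)
  exact eq_of_le_of_inf_le_of_sup_le h hinf hsup.ge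

end ChainConditions

section StableFamilies

variable {A : Type u} [Category.{v} A] {S : Type t} [Ring S] {F G H : A ⥤ ModuleCat.{w} S}

/-- The lattice of subfunctors of `F`, encoded as families of submodules of the values of `F` that
are stable under the action of `F` on morphisms. -/
def stableFamilies (F : A ⥤ ModuleCat.{w} S) : Sublattice (∀ y, Submodule S (F.obj y)) where
  carrier := {L | ∀ ⦃y z : A⦄ (f : y ⟶ z), L y ≤ (L z).comap (F.map f).hom}
  supClosed' := fun _ hL _ hH _ _ f ↦
    sup_le ((hL f).trans (Submodule.comap_mono le_sup_left))
      ((hH f).trans (Submodule.comap_mono le_sup_right))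
  infClosed' := fun _ hL _ hH _ _ f ↦ le_inf (inf_le_left.trans (hL f)) (inf_le_right.trans (hH f))

instance : IsModularLattice (stableFamilies F) where
  sup_inf_le_assoc_of_le {_} L {_} h y := IsModularLattice.sup_inf_le_assoc_of_le (L.1 y) (h y)

theorem mem_of_map_map_eq {L L' : stableFamilies F} {y b : A} (hb : L.1 b ≤ L'.1 b) {m : F.obj y}
    (hm : m ∈ L.1 y) {f : y ⟶ b} {g : b ⟶ y} (hfg : F.map g (F.map f m) = m) : m ∈ L'.1 y :=
  hfg ▸ L'.2 g (hb (L.2 f hm))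

theorem le_of_retract {L L' : stableFamilies F} {y b : A} (r : Retract y b)
    (hb : L.1 b ≤ L'.1 b) : L.1 y ≤ L'.1 y := fun m hm ↦
  mem_of_map_map_eq hb hm (f := r.i) (g := r.r) <| by
    rw [← ConcreteCategory.comp_apply, ← F.map_comp, r.retract, F.map_id,
      ConcreteCategory.id_apply]

/-- The subfunctor attached to a stable family. -/
def subfunctor (L : stableFamilies F) : A ⥤ ModuleCat.{w} S where
  obj y := ModuleCat.of S (L.1 y)
  map f := ModuleCat.ofHom ((F.map f).hom.restrict fun _ h ↦ L.2 f h)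

/-- The inclusion of a subfunctor. -/
def subfunctorι (L : stableFamilies F) : subfunctor L ⟶ F where
  app y := ModuleCat.ofHom (L.1 y).subtype

instance (L : stableFamilies F) : Mono (subfunctorι L) := by
  have (y : A) : Mono ((subfunctorι L).app y) :=
    (ModuleCat.mono_iff_injective _).2 Subtype.val_injective
  exact NatTrans.mono_of_mono_app _

/-- The quotient functor attached to a stable family. -/
def quotientFunctor (L : stableFamilies F) : A ⥤ ModuleCat.{w} S where
  obj y := ModuleCat.of S (F.obj y ⧸ L.1 y)
  map f := ModuleCat.ofHom (Submodule.mapQ _ _ (F.map f).hom (L.2 f))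

/-- The projection onto a quotient functor. -/
def quotientFunctorπ (L : stableFamilies F) : F ⟶ quotientFunctor L where
  app y := ModuleCat.ofHom (L.1 y).mkQ

instance (L : stableFamilies F) : Epi (quotientFunctorπ L) := by
  have (y : A) : Epi ((quotientFunctorπ L).app y) :=
    (ModuleCat.epi_iff_surjective _).2 (Submodule.mkQ_surjective _)
  exact NatTrans.epi_of_epi_app _

/-- The image of a natural transformation. -/
def rangeFamily (φ : G ⟶ F) : stableFamilies F :=
  ⟨fun y ↦ LinearMap.range (φ.app y).hom, by
    rintro y z f _ ⟨m, rfl⟩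
    exact ⟨G.map f m, NatTrans.naturality_apply φ f m⟩⟩

theorem rangeFamily_comp_le (ψ : H ⟶ G) (φ : G ⟶ F) : rangeFamily (ψ ≫ φ) ≤ rangeFamily φ := by
  rintro y _ ⟨m, rfl⟩
  exact ⟨ψ.app y m, rfl⟩

theorem rangeFamily_comp_of_isIso (ψ : H ⟶ G) [IsIso ψ] (φ : G ⟶ F) :
    rangeFamily (ψ ≫ φ) = rangeFamily φ :=
  (rangeFamily_comp_le ψ φ).antisymm (by simpa using rangeFamily_comp_le (inv ψ) (ψ ≫ φ))

theorem rangeFamily_subfunctorι (L : stableFamilies F) : rangeFamily (subfunctorι L) = L :=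
  Subtype.ext (funext fun y ↦ Submodule.range_subtype (L.1 y))

theorem exists_comp_eq_of_rangeFamily_le {φ : G ⟶ F} [Mono φ] {ψ : H ⟶ F}
    (h : rangeFamily ψ ≤ rangeFamily φ) : ∃ χ : H ⟶ G, χ ≫ φ = ψ := by
  have hφ (y : A) : Function.Injective (φ.app y).hom :=
    (ModuleCat.mono_iff_injective _).1 inferInstance
  choose χ hχ using fun y m ↦ h y ⟨m, rfl⟩
  refine ⟨{ app y := ModuleCat.ofHom
              { toFun := χ y
                map_add' := fun m n ↦ hφ y (by simp only [map_add, hχ])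
                map_smul' := fun r m ↦ hφ y (by simp only [map_smul, hχ, RingHom.id_apply]) }
            naturality y z f := ?_ }, ?_⟩
  · ext m
    refine hφ z ((hχ z (H.map f m)).trans ?_)
    refine (NatTrans.naturality_apply ψ f m).trans ?_
    refine Eq.trans ?_ (NatTrans.naturality_apply φ f (χ y m)).symm
    exact congrArg (F.map f) (hχ y m).symm
  · ext y m
    exact hχ y m

/-- The preimage of a stable family under a natural transformation. -/
def comapFamily (φ : G ⟶ F) (L : stableFamilies F) : stableFamilies G :=
  ⟨fun y ↦ (L.1 y).comap (φ.app y).hom, fun y z f m hm ↦ by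
    rw [Submodule.mem_comap, Submodule.mem_comap]
    exact (NatTrans.naturality_apply φ f m).symm ▸ L.2 f hm⟩

theorem strictMono_comapFamily (φ : G ⟶ F) :
    StrictMono fun L : Set.Iic (rangeFamily φ) ↦ comapFamily φ L := by
  refine fun L L' hlt ↦ lt_of_le_not_ge (fun y ↦ Submodule.comap_mono (hlt.le y)) fun hge ↦
    hlt.not_ge fun y m hm ↦ ?_
  obtain ⟨n, rfl⟩ := L'.2 y hm
  exact hge y hm

/-- The sum of the stable families of finite height. -/
def finiteHeightFamily (F : A ⥤ ModuleCat.{w} S) : stableFamilies F :=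
  ⟨fun y ↦
    { carrier := {m | ∃ L : stableFamilies F, IsFiniteHeight L ∧ m ∈ L.1 y}
      zero_mem' := by
        let bot : stableFamilies F := ⟨⊥, fun _ _ _ ↦ bot_le⟩
        have : Unique (Set.Iic bot) :=
          ⟨⟨⟨bot, Set.self_mem_Iic⟩⟩, fun L ↦ Subtype.ext (le_antisymm L.2 fun _ ↦ bot_le)⟩
        exact ⟨bot, ⟨inferInstance, inferInstance⟩, zero_mem _⟩
      add_mem' := by
        rintro a b ⟨L, hL, ha⟩ ⟨L', hL', hb⟩
        exact ⟨L ⊔ L', hL.sup hL', add_mem (Submodule.mem_sup_left ha) (Submodule.mem_sup_right hb)⟩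
      smul_mem' := by
        rintro c a ⟨L, hL, ha⟩
        exact ⟨L, hL, Submodule.smul_mem _ c ha⟩ },
    fun _ _ f _ ⟨L, hL, ha⟩ ↦ ⟨L, hL, L.2 f ha⟩⟩

end StableFamilies

section LocallyFinite

variable {A : Type u} [Category.{v} A] {S : Type t} [Ring S] {C : Type*} [Category C]

section Corepresentable

variable {Φ : C ⥤ (A ⥤ ModuleCat.{w} S)} {x : A} {X : C}
  (hX : (Φ ⋙ (evaluation A _).obj x ⋙ forget _).CorepresentableBy X)

/-- The element corresponding to the identity of a representing object. -/
def universalElement : (Φ.obj X).obj x := hX.homEquiv (𝟙 X)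

theorem homEquiv_eq_app_universalElement {Y : C} (f : X ⟶ Y) :
    hX.homEquiv f = (Φ.map f).app x (universalElement hX) := hX.homEquiv_eq f

end Corepresentable

/-- A functor identifying its source with a full subcategory, closed under subobjects and quotients,
of a category of functors to modules. -/
class IsSubquotientClosed (Φ : C ⥤ (A ⥤ ModuleCat.{w} S)) : Prop where
  full : Φ.Full
  faithful : Φ.Faithful
  sub : ∀ {X : C} {G : A ⥤ ModuleCat.{w} S} (i : G ⟶ Φ.obj X) [Mono i], Φ.essImage G
  quot : ∀ {X : C} {G : A ⥤ ModuleCat.{w} S} (p : Φ.obj X ⟶ G) [Epi p], Φ.essImage G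

attribute [instance] IsSubquotientClosed.full IsSubquotientClosed.faithful

variable (Φ : C ⥤ (A ⥤ ModuleCat.{w} S)) [IsSubquotientClosed Φ]

theorem preservesMonomorphisms_of_isSubquotientClosed : Φ.PreservesMonomorphisms where
  preserves {X Y} f _ := by
    refine Preadditive.mono_of_kernel_zero ?_
    obtain ⟨K, ⟨e⟩⟩ := IsSubquotientClosed.sub (kernel.ι (Φ.map f))
    have h : Φ.preimage (e.hom ≫ kernel.ι (Φ.map f)) = Φ.preimage 0 := by
      rw [← cancel_mono f]
      exact Φ.map_injective (by simp)
    rw [← cancel_epi e.hom, comp_zero, ← Φ.map_preimage (e.hom ≫ _), h, Φ.map_preimage]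

theorem mk_le_mk_iff_rangeFamily_le {X Y Z : C} (f : Y ⟶ X) (g : Z ⟶ X) [Mono f] [Mono g] :
    Subobject.mk f ≤ Subobject.mk g ↔ rangeFamily (Φ.map f) ≤ rangeFamily (Φ.map g) := by
  constructor
  · intro h
    rw [← Subobject.ofMkLEMk_comp h, Φ.map_comp]
    exact rangeFamily_comp_le _ _
  · intro h
    have := preservesMonomorphisms_of_isSubquotientClosed Φ
    obtain ⟨χ, hχ⟩ := exists_comp_eq_of_rangeFamily_le h
    exact Subobject.mk_le_mk_of_comm (Φ.preimage χ) (Φ.map_injective (by simp [hχ]))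

/-- Subobjects of `X` correspond to stable families of submodules of the functor `Φ.obj X`. -/
noncomputable def subobjectOrderIso (X : C) : Subobject X ≃o stableFamilies (Φ.obj X) :=
  RelIso.ofSurjective
    (OrderEmbedding.ofMapLEIff (fun s ↦ rangeFamily (Φ.map s.arrow)) fun s s' ↦ by
      rw [← mk_le_mk_iff_rangeFamily_le, Subobject.mk_arrow, Subobject.mk_arrow])
    fun L ↦ by
      obtain ⟨K, ⟨e⟩⟩ := IsSubquotientClosed.sub (subfunctorι L)
      let j : K ⟶ X := Φ.preimage (e.hom ≫ subfunctorι L)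
      have hj : Φ.map j = e.hom ≫ subfunctorι L := Φ.map_preimage _
      have : Mono j := Φ.mono_of_mono_map (by rw [hj]; infer_instance)
      refine ⟨Subobject.mk j, ?_⟩
      change rangeFamily (Φ.map (Subobject.mk j).arrow) = L
      rw [← Subobject.underlyingIso_hom_comp_eq_mk, Φ.map_comp, rangeFamily_comp_of_isIso, hj,
        rangeFamily_comp_of_isIso, rangeFamily_subfunctorι]

theorem isFiniteLength_iff (X : C) :
    isFiniteLength C X ↔ HasChainConditions (stableFamilies (Φ.obj X)) := by
  have e := subobjectOrderIso Φ X
  refine ⟨fun h ↦ ?_, fun h ↦ ?_⟩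
  · have h' : HasChainConditions (Subobject X) := ⟨h.2, h.1⟩
    exact h'.of_strictMono e.symm.strictMono
  · have h' := h.of_strictMono e.strictMono
    exact ⟨h'.wellFoundedGT, h'.wellFoundedLT⟩

variable {Φ}

theorem isFiniteHeight_rangeFamily {X : C} (hX : isFiniteLength C X) {F : A ⥤ ModuleCat.{w} S}
    (φ : Φ.obj X ⟶ F) : IsFiniteHeight (rangeFamily φ) :=
  ((isFiniteLength_iff Φ X).1 hX).of_strictMono (strictMono_comapFamily φ)

theorem hom_ext_of_isLocallyFinite (h : IsLocallyFinite C) {X : C} {G : A ⥤ ModuleCat.{w} S}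
    (hG : Φ.essImage G) {π π' : Φ.obj X ⟶ G}
    (hπ : ∀ Y, isFiniteLength C Y → ∀ f : Y ⟶ X, Φ.map f ≫ π = Φ.map f ≫ π') : π = π' := by
  obtain ⟨Q, ⟨e⟩⟩ := hG
  obtain ⟨g, hg⟩ := Φ.map_surjective (π ≫ e.inv)
  obtain ⟨g', hg'⟩ := Φ.map_surjective (π' ≫ e.inv)
  rw [← cancel_mono e.inv, ← hg, ← hg']
  refine congrArg Φ.map (h g g' fun Y hY f ↦ Φ.map_injective ?_)
  rw [Φ.map_comp, Φ.map_comp, hg, hg', ← Category.assoc, hπ Y hY, Category.assoc]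

theorem exists_isFiniteHeight_mem (h : IsLocallyFinite C) {X : C} {x : A} (ξ : (Φ.obj X).obj x) :
    ∃ L : stableFamilies (Φ.obj X), IsFiniteHeight L ∧ ξ ∈ L.1 x := by
  let π := quotientFunctorπ (finiteHeightFamily (Φ.obj X))
  have hπ : π = 0 := by
    refine hom_ext_of_isLocallyFinite h (IsSubquotientClosed.quot π) fun Y hY f ↦ ?_
    rw [comp_zero]
    ext y m
    exact (Submodule.Quotient.mk_eq_zero _).2
      ⟨_, isFiniteHeight_rangeFamily hY (Φ.map f), ⟨m, rfl⟩⟩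
  exact (Submodule.Quotient.mk_eq_zero _).1 (congrArg (fun φ ↦ φ.app x ξ) hπ)

variable {x : A} {X : C} (hX : (Φ ⋙ (evaluation A _).obj x ⋙ forget _).CorepresentableBy X)

theorem hom_ext_of_corepresentableBy {G : A ⥤ ModuleCat.{w} S} (hG : Φ.essImage G)
    {π π' : Φ.obj X ⟶ G} (hπ : π.app x (universalElement hX) = π'.app x (universalElement hX)) :
    π = π' := by
  obtain ⟨Q, ⟨e⟩⟩ := hG
  obtain ⟨g, hg⟩ := Φ.map_surjective (π ≫ e.inv)
  obtain ⟨g', hg'⟩ := Φ.map_surjective (π' ≫ e.inv)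
  rw [← cancel_mono e.inv, ← hg, ← hg']
  refine congrArg Φ.map (hX.homEquiv.injective ?_)
  rw [homEquiv_eq_app_universalElement, homEquiv_eq_app_universalElement, hg, hg']
  exact congrArg (e.inv.app x) hπ

theorem le_of_universalElement_mem {L : stableFamilies (Φ.obj X)}
    (hL : universalElement hX ∈ L.1 x) (L' : stableFamilies (Φ.obj X)) : L' ≤ L := by
  have hπ : quotientFunctorπ L = 0 := hom_ext_of_corepresentableBy hX
    (IsSubquotientClosed.quot (quotientFunctorπ L)) ((Submodule.Quotient.mk_eq_zero _).2 hL)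
  exact fun y m _ ↦ (Submodule.Quotient.mk_eq_zero _).1 (congrArg (fun φ ↦ φ.app y m) hπ)

theorem isLocallyFinite_iff {P : A → C}
    (hP : ∀ x, (Φ ⋙ (evaluation A _).obj x ⋙ forget _).CorepresentableBy (P x)) :
    IsLocallyFinite C ↔ ∀ x, HasChainConditions (stableFamilies (Φ.obj (P x))) := by
  refine ⟨fun h x ↦ ?_, fun h Y Z f g hfg ↦ Φ.map_injective ?_⟩
  · obtain ⟨L, hL, hx⟩ := exists_isFiniteHeight_mem h (universalElement (hP x))
    exact hL.hasChainConditions (le_of_universalElement_mem (hP x) hx)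
  · ext x η
    obtain ⟨m, rfl⟩ := (hP x).homEquiv.surjective η
    have := congrArg (hP x).homEquiv (hfg (P x) ((isFiniteLength_iff Φ _).2 (h x)) m)
    rw [homEquiv_eq_app_universalElement, homEquiv_eq_app_universalElement, Φ.map_comp,
      Φ.map_comp] at this
    rw [homEquiv_eq_app_universalElement]
    exact this

end LocallyFinite

section DeterminingObject

variable {A : Type u} [Category.{v} A] {S : Type t} [Ring S] {F : A ⥤ ModuleCat.{w} S}

/-- Stable families below `N`, comparable to each other, are determined by their value at `b`. -/
def DeterminesBelow (N : stableFamilies F) (b : A) : Prop :=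
  ∀ ⦃L K : stableFamilies F⦄, K ≤ L → L ≤ N → L.1 b ≤ K.1 b → L ≤ K

/-- Adding to `b` an object at which `N` and `N'` differ decides whether a family lies
below `N'`; two families agreeing on this point are compared through their traces on `N'`. -/
theorem DeterminesBelow.of_covBy [Preadditive A] [HasBinaryBiproducts A]
    {N N' : stableFamilies F} {b : A} (hb : DeterminesBelow N' b) (hN : N' ⋖ N) :
    ∃ b', DeterminesBelow N b' := by
  obtain ⟨s, hs⟩ : ∃ s, ¬ N.1 s ≤ N'.1 s := by
    by_contra! h
    exact hN.1.not_ge h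
  refine ⟨b ⊞ s, fun L L' hL'L hLN h ↦ ?_⟩
  have hLb : L.1 b ≤ L'.1 b := le_of_retract ⟨biprod.inl, biprod.fst, biprod.inl_fst⟩ h
  have hLs : L.1 s ≤ L'.1 s := le_of_retract ⟨biprod.inr, biprod.snd, biprod.inr_snd⟩ h
  have hinf : L ⊓ N' ≤ L' ⊓ N' :=
    hb (inf_le_inf_right N' hL'L) inf_le_right (inf_le_inf_right (N'.1 b) hLb)
  have hsup {K : stableFamilies F} (hK : K ≤ N) (hK' : ¬ K ≤ N') : K ⊔ N' = N :=
    (hN.eq_or_eq le_sup_right (sup_le hK hN.1.le)).resolve_left fun h ↦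
      hK' (h ▸ le_sup_left)
  by_cases hLN' : L ≤ N'
  · exact (le_inf le_rfl hLN').trans (hinf.trans inf_le_left)
  have hL'N' : ¬ L' ≤ N' := fun h' ↦ hs <| by
    rw [← hsup hLN hLN']
    exact sup_le (hLs.trans (h' s)) le_rfl
  exact (eq_of_le_of_inf_le_of_sup_le hL'L hinf
    ((hsup hLN hLN').trans (hsup (hL'L.trans hLN) hL'N').symm).le).ge

theorem exists_determiningObject [Preadditive A] [HasBinaryBiproducts A] [Nonempty A]
    (hF : HasChainConditions (stableFamilies F)) :
    ∃ b, ∀ L L' : stableFamilies F, L.1 b ≤ L'.1 b → L ≤ L' := by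
  have := hF.wellFoundedLT
  have := hF.wellFoundedGT
  have below (N : stableFamilies F) : ∃ b, DeterminesBelow N b := by
    induction N using WellFoundedLT.induction with
    | ind N ih =>
    by_cases hN : IsMin N
    · exact ⟨Classical.arbitrary A, fun L L' hL'L hLN _ ↦ hLN.trans (hN (hL'L.trans hLN))⟩
    obtain ⟨N', hN'⟩ := not_isMin_iff.1 hN
    obtain ⟨N'', -, hcov⟩ := exists_le_covBy_of_lt hN'
    obtain ⟨b, hb⟩ := ih N'' hcov.1
    exact hb.of_covBy hcov
  obtain ⟨b, hb⟩ := below ⟨⊤, fun _ _ _ ↦ le_top⟩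
  exact ⟨b, fun L L' h ↦
    (hb inf_le_left (fun _ ↦ le_top) (le_inf le_rfl h)).trans inf_le_right⟩

end DeterminingObject

section Through

variable {A : Type u} [Category.{v} A] [Preadditive A]

/-- The morphisms from `y` to `z` that are sums of morphisms factoring through `t`. -/
def through (t y z : A) : Submodule ℤ (y ⟶ z) :=
  Submodule.span ℤ (Set.range fun p : (y ⟶ t) × (t ⟶ z) ↦ p.1 ≫ p.2)

theorem comp_mem_through (t : A) {y z z' : A} {e : y ⟶ z} (he : e ∈ through t y z) (f : z ⟶ z') :
    e ≫ f ∈ through t y z' := by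
  suffices through t y z ≤ (through t y z').comap (Preadditive.rightComp y f).toIntLinearMap from
    this he
  refine Submodule.span_le.2 ?_
  rintro _ ⟨p, rfl⟩
  exact Submodule.subset_span ⟨(p.1, p.2 ≫ f), (Category.assoc ..).symm⟩

theorem exists_eq_sum_of_mem_through {t y z : A} {e : y ⟶ z} (he : e ∈ through t y z) :
    ∃ (n : ℕ) (f : Fin n → (y ⟶ t)) (g : Fin n → (t ⟶ z)), ∑ i, f i ≫ g i = e := by
  obtain ⟨n, c, p, rfl⟩ := (Submodule.mem_span_set').1 he
  choose p' hp' using fun i ↦ (p i).2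
  refine ⟨n, fun i ↦ (p' i).1, fun i ↦ c i • (p' i).2, Finset.sum_congr rfl fun i _ ↦ ?_⟩
  rw [Preadditive.comp_zsmul, ← hp']

variable {S : Type t} [Ring S] (D : A ⥤ ModuleCat.{w} S) [D.Additive]

/-- If `m` is fixed by `e₁` and `m' - e₁ m'` is fixed by `e₂`, then `e₁ + e₂ - e₁ e₂` fixes both. -/
theorem exists_mem_through_forall_map_eq {t y : A}
    (h : ∀ m : D.obj y, ∃ e ∈ through t y y, D.map e m = m) (s : Finset (D.obj y)) :
    ∃ e ∈ through t y y, ∀ m ∈ s, D.map e m = m := by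
  classical
  induction s using Finset.induction_on with
  | empty => exact ⟨0, zero_mem _, by simp⟩
  | insert m s _ ih =>
    obtain ⟨e₁, he₁, hs⟩ := ih
    obtain ⟨e₂, he₂, hm⟩ := h (m - D.map e₁ m)
    have hmap (n : D.obj y) :
        D.map (e₁ + e₂ - e₁ ≫ e₂) n = D.map e₁ n + D.map e₂ (n - D.map e₁ n) := by
      simp [D.map_add, D.map_sub, add_sub_assoc]
    refine ⟨e₁ + e₂ - e₁ ≫ e₂, sub_mem (add_mem he₁ he₂) (comp_mem_through t he₁ e₂),
      fun n hn ↦ ?_⟩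
    rw [hmap]
    obtain rfl | hn := Finset.mem_insert.1 hn
    · rw [hm, add_sub_cancel]
    · rw [hs n hn, sub_self, map_zero, add_zero]

end Through

section Orbit

variable {A : Type u} [Category.{v} A] [Preadditive A] (D : A ⥤ ModuleCat.{w} ℤ) [D.Additive]

/-- The action of morphisms on an element. -/
def evalAt {y : A} (m : D.obj y) (z : A) : (y ⟶ z) →ₗ[ℤ] D.obj z where
  toFun f := D.map f m
  map_add' f g := by simp [D.map_add]
  map_smul' c f := by
    rw [D.map_zsmul]
    exact (Int.cast_smul_eq_zsmul ℤ c (D.map f m)).symm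

/-- The stable family generated by an element, or rather its part coming from the morphisms in a
right ideal `I`. -/
def orbitFamily {y : A} (m : D.obj y) (I : ∀ z, Submodule ℤ (y ⟶ z))
    (hI : ∀ ⦃z z'⦄ ⦃f : y ⟶ z⦄, f ∈ I z → ∀ g : z ⟶ z', f ≫ g ∈ I z') : stableFamilies D :=
  ⟨fun z ↦ (I z).map (evalAt D m z), by
    rintro z z' g _ ⟨f, hf, rfl⟩
    exact ⟨f ≫ g, hI hf g, by simp [evalAt]⟩⟩

theorem exists_forall_mem_through_map_eq [HasBinaryBiproducts A] [Nonempty A]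
    (hD : HasChainConditions (stableFamilies D)) :
    ∃ t, ∀ y (m : D.obj y), ∃ e ∈ through t y y, D.map e m = m := by
  obtain ⟨b, hb⟩ := exists_determiningObject hD
  refine ⟨b, fun y m ↦ ?_⟩
  have hle := hb (orbitFamily D m ⊤ fun _ _ _ _ _ ↦ trivial)
    (orbitFamily D m (through b y) fun _ _ _ ↦ comp_mem_through b) <| by
      rintro _ ⟨f, -, rfl⟩
      exact ⟨f, Submodule.subset_span ⟨(f, 𝟙 b), Category.comp_id f⟩, rfl⟩
  exact hle y ⟨𝟙 y, trivial, by simp [evalAt]⟩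

end Orbit

section Power

variable {A : Type u} [Category.{v} A] [Preadditive A] [HasFiniteBiproducts A]

/-- The biproduct of copies of `y` indexed by `ι`. -/
noncomputable abbrev power (y : A) (ι : Type) [Finite ι] : A := ⨁ fun _ : ι ↦ y

/-- The endomorphism of a power given by a matrix. Rows index the components of the target. -/
noncomputable def matrixEnd (y : A) (ι : Type) [Fintype ι] [DecidableEq ι] :
    Matrix ι ι (End y) →* End (power y ι) where
  toFun a := biproduct.matrix fun j i ↦ a i j
  map_one' := by
    refine biproduct.hom_ext' _ _ fun j ↦ biproduct.hom_ext _ _ fun i ↦ ?_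
    obtain rfl | h := eq_or_ne i j
    · simp [End.one_def]
    · simp [End.one_def, Matrix.one_apply_ne h, biproduct.ι_π_ne _ h.symm]
  map_mul' a b := by
    refine biproduct.hom_ext' _ _ fun j ↦ biproduct.hom_ext _ _ fun i ↦ ?_
    simp [Matrix.mul_apply, End.mul_def, biproduct.lift_desc]

theorem matrixEnd_eraseCoord (y : A) {ι : Type} [Fintype ι] [DecidableEq ι] (j : ι) :
    matrixEnd y ι (eraseCoord (End y) j) =
      biproduct.toSubtype (fun _ : ι ↦ y) (· ≠ j) ≫ biproduct.fromSubtype _ (· ≠ j) := by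
  rw [biproduct.toSubtype_fromSubtype]
  refine biproduct.hom_ext' _ _ fun l ↦ biproduct.hom_ext _ _ fun i ↦ ?_
  obtain rfl | h := eq_or_ne l i
  · simp [matrixEnd, eraseCoord, Function.update_apply, End.one_def]
  · simp [matrixEnd, eraseCoord, h.symm, biproduct.ι_π_ne _ h]

/-- The powers with fewer factors are retracts of those with more. -/
noncomputable def retractPower (y : A) {ι κ : Type} [Finite ι] [Finite κ] (e : ι ↪ κ) :
    Retract (power y ι) (power y κ) where
  i := biproduct.desc fun i ↦ biproduct.ι (fun _ : κ ↦ y) (e i)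
  r := biproduct.lift fun i ↦ biproduct.π (fun _ : κ ↦ y) (e i)
  retract := by
    ext i j
    obtain rfl | h := eq_or_ne j i
    · simp
    · simp [biproduct.ι_π_ne _ h, biproduct.ι_π_ne _ (e.injective.ne h)]

end Power

section PowerRep

theorem asAlgebraHom_mem_of_mem_span {k G V : Type*} [CommRing k] [Monoid G] [AddCommGroup V]
    [Module k V] (ρ : Representation k G V) {L L' : Submodule k V}
    (hL : ∀ g, ∀ v ∈ L, ρ g v ∈ L) (hL' : ∀ g, ∀ v ∈ L', ρ g v ∈ L') {s : Set k[G]}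
    (hs : ∀ Y ∈ s, ∀ v ∈ L, ρ.asAlgebraHom Y v ∈ L') {X : k[G]} (hX : X ∈ TwoSidedIdeal.span s) :
    ∀ v ∈ L, ρ.asAlgebraHom X v ∈ L' := by
  induction hX using TwoSidedIdeal.span_induction with
  | mem Y hY => exact hs Y hY
  | zero => simp
  | add Y Z _ _ hY hZ => exact fun v hv ↦ by simpa using add_mem (hY v hv) (hZ v hv)
  | neg Y _ hY => exact fun v hv ↦ by simpa using hY v hv
  | left_absorb Z Y _ hY =>
    intro v hv
    rw [map_mul]
    exact ρ.asAlgebraHom_mem_of_forall_mem L' hL' _ (hY v hv) Z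
  | right_absorb Z Y _ hY =>
    intro v hv
    rw [map_mul]
    exact hY _ (ρ.asAlgebraHom_mem_of_forall_mem L hL v hv Z)

variable {A : Type u} [Category.{v} A] [Preadditive A] [HasFiniteBiproducts A]
  {k : Type t} [CommRing k] (F : A ⥤ ModuleCat.{w} k)
  (y : A) (ι : Type) [Fintype ι] [DecidableEq ι]

/-- The action of matrices on the value of a functor at a power. -/
noncomputable def powerRep : Representation k (Matrix ι ι (End y)) (F.obj (power y ι)) :=
  ((ModuleCat.endRingEquiv (F.obj (power y ι))).toMonoidHom.comp (F.mapEnd (power y ι))).comp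
    (matrixEnd y ι)

variable {F y ι}

theorem powerRep_apply (a : Matrix ι ι (End y)) (m : F.obj (power y ι)) :
    powerRep F y ι a m = F.map (matrixEnd y ι a) m := rfl

/-- The erasure of a coordinate factors through a smaller power, so that the matrices of the
erasure ideal send `L` to `L'`. -/
theorem le_power_of_forall_le_power_erase {L L' : stableFamilies F} {X : k[Matrix ι ι (End y)]}
    (hX : X ∈ erasureIdeal k (End y) ι) (hX1 : (powerRep F y ι).asAlgebraHom X = 1)
    (h : ∀ j : ι, L.1 (power y {i // i ≠ j}) ≤ L'.1 (power y {i // i ≠ j})) :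
    L.1 (power y ι) ≤ L'.1 (power y ι) := by
  intro m hm
  rw [← Module.End.one_apply (R := k) m, ← hX1]
  refine asAlgebraHom_mem_of_mem_span (powerRep F y ι) (fun a _ hn ↦ L.2 (matrixEnd y ι a) hn)
    (fun a _ hn ↦ L'.2 (matrixEnd y ι a) hn) ?_ hX m hm
  rintro _ ⟨j, rfl⟩ n hn
  rw [Representation.asAlgebraHom_of, powerRep_apply, matrixEnd_eraseCoord, F.map_comp]
  exact L'.2 _ (h j (L.2 _ hn))

end PowerRep

section Linearization

variable {A : Type u} [Category.{v} A] {S : Type t} [Ring S] (D : A ⥤ ModuleCat.{w} S)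
  (k : Type w) [CommRing k]

/-- The functor of formal linear combinations of elements of the values of a functor. -/
noncomputable abbrev linearization : A ⥤ ModuleCat.{w} k := D ⋙ forget _ ⋙ ModuleCat.free k

variable {D k}

theorem linearization_map_freeMk {y z : A} (f : y ⟶ z) (m : D.obj y) :
    (linearization D k).map f (ModuleCat.freeMk m) = ModuleCat.freeMk (D.map f m) :=
  ModuleCat.free_map_apply _ _

theorem linearization_map_eq_self {y : A} {e : y ⟶ y} (v : (linearization D k).obj y)
    (he : ∀ m ∈ (v : D.obj y →₀ k).support, D.map e m = m) : (linearization D k).map e v = v :=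
  (Finsupp.mapDomain_congr he).trans Finsupp.mapDomain_id

end Linearization

section TestObject

variable {A : Type u} [Category.{v} A] [Preadditive A] [HasFiniteBiproducts A]
  {S : Type t} [Ring S] (D : A ⥤ ModuleCat.{w} S) [D.Additive] {k : Type w} [CommRing k]

/-- The value of an additive functor at `y`, as a module over the endomorphisms of `y`. -/
abbrev endModule (y : A) : Module (End y) (D.obj y) :=
  Module.compHom (D.obj y) (((ModuleCat.endRingEquiv (D.obj y)).toRingHom).comp
    { (D.mapEnd y) with
      map_zero' := D.map_zero y y
      map_add' _ _ := D.map_add })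

/-- The element of `D.obj (power y ι)` with given components. -/
noncomputable def ofComponents (y : A) (ι : Type) [Fintype ι] (m : ι → D.obj y) :
    D.obj (power y ι) :=
  ∑ i, D.map (biproduct.ι (fun _ : ι ↦ y) i) (m i)

theorem surjective_ofComponents (y : A) (ι : Type) [Fintype ι] :
    Function.Surjective (ofComponents D y ι) := fun m ↦
  ⟨fun i ↦ D.map (biproduct.π (fun _ : ι ↦ y) i) m, by
    have h : ∑ i, biproduct.π (fun _ ↦ y) i ≫ biproduct.ι (fun _ ↦ y) i = 𝟙 (power y ι) :=
      biproduct.total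
    calc
      _ = D.map (∑ i, biproduct.π (fun _ ↦ y) i ≫ biproduct.ι (fun _ ↦ y) i) m := by
        rw [D.map_sum]
        simp [ofComponents, -biproduct.total]
      _ = m := by simp [h]⟩

attribute [local instance] endModule in
theorem ofComponents_smul (y : A) (ι : Type) [Fintype ι] [DecidableEq ι]
    (a : Matrix ι ι (End y)) (m : ι → D.obj y) :
    ofComponents D y ι (a • m) = D.map (matrixEnd y ι a) (ofComponents D y ι m) := by
  have hι (j : ι) : biproduct.ι (fun _ : ι ↦ y) j ≫ matrixEnd y ι a =
      ∑ i, (a i j : y ⟶ y) ≫ biproduct.ι (fun _ : ι ↦ y) i := by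
    simp [matrixEnd, biproduct.lift_eq]
  have hsmul (f : End y) (n : D.obj y) : f • n = D.map f n := rfl
  simp only [ofComponents, Matrix.Module.smul_apply, map_sum, hsmul]
  rw [Finset.sum_comm]
  refine Finset.sum_congr rfl fun j _ ↦ ?_
  rw [← ConcreteCategory.comp_apply, ← D.map_comp, hι, D.map_sum]
  simp

attribute [local instance] endModule in
theorem powerRep_linearization_eq_one {y : A} {ι : Type} [Fintype ι] [DecidableEq ι]
    {X : k[Matrix ι ι (End y)]} (hX : linAct k _ (ι → D.obj y) X = 1) :
    (powerRep (linearization D k) y ι).asAlgebraHom X = 1 := by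
  let f (m : ι → D.obj y) : (linearization D k).obj (power y ι) :=
    ModuleCat.freeMk (ofComponents D y ι m)
  suffices ModuleCat.ofHom ((powerRep (linearization D k) y ι).asAlgebraHom X) = 𝟙 _ from
    congrArg ModuleCat.Hom.hom this
  refine ModuleCat.free_hom_ext fun m ↦ ?_
  obtain ⟨m, rfl⟩ := surjective_ofComponents D y ι m
  refine asAlgebraHom_apply_eq_of_linAct_eq (f := f) (fun a n ↦ ?_) (x := m) (by rw [hX]; rfl)
  exact (congrArg ModuleCat.freeMk (ofComponents_smul D y ι a n)).trans
    (linearization_map_freeMk _ _).symm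

variable {D} in
/-- Beyond the number of factors given by the matrix identity, the value of a family at a power is
controlled by those at smaller powers; below it, powers are retracts of one test object. -/
theorem exists_forall_le_power {t : A} [Finite (End t)] [Finite (D.obj t)]
    (ht : IsUnit (Nat.card (End t) : k)) :
    ∃ b, ∀ L L' : stableFamilies (linearization D k), L.1 b ≤ L'.1 b →
      ∀ (ι : Type) [Fintype ι], L.1 (power t ι) ≤ L'.1 (power t ι) := by
  let := endModule D t
  obtain ⟨n, hn⟩ := exists_forall_exists_mem_erasureIdeal_linAct_eq_one ht (D.obj t)
  refine ⟨power t (Fin n), fun L L' hb ι _ ↦ ?_⟩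
  induction hc : Fintype.card ι using Nat.strong_induction_on generalizing ι with
  | h c ih =>
  classical
  obtain hcn | hcn := le_total n c
  · obtain ⟨X, hX, hX1⟩ := hn ι (hc ▸ hcn)
    refine le_power_of_forall_le_power_erase hX (powerRep_linearization_eq_one D hX1) fun j ↦ ?_
    subst hc
    exact ih _ (Fintype.card_subtype_lt (x := j) (by simp)) {i // i ≠ j} inferInstance rfl
  · obtain ⟨e⟩ : Nonempty (ι ↪ Fin n) :=
      Function.Embedding.nonempty_of_card_le (by rwa [hc, Fintype.card_fin])
    exact le_of_retract (retractPower t e) hb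

variable {D} in
theorem exists_testObject {t : A} [Finite (End t)] [Finite (D.obj t)]
    (ht : IsUnit (Nat.card (End t) : k))
    (h : ∀ y (m : D.obj y), ∃ e ∈ through t y y, D.map e m = m) :
    ∃ b, ∀ L L' : stableFamilies (linearization D k), L.1 b ≤ L'.1 b → L ≤ L' := by
  obtain ⟨b, hb⟩ := exists_forall_le_power (D := D) ht
  refine ⟨b, fun L L' hLL' y v hv ↦ ?_⟩
  obtain ⟨e, he, hev⟩ :=
    exists_mem_through_forall_map_eq D (h y) (v : D.obj y →₀ k).support
  obtain ⟨n, f, g, rfl⟩ := exists_eq_sum_of_mem_through he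
  refine mem_of_map_map_eq (hb L L' hLL' (Fin n)) hv (f := biproduct.lift f)
    (g := biproduct.desc g) ?_
  rw [← ConcreteCategory.comp_apply, ← Functor.map_comp, biproduct.lift_desc]
  exact linearization_map_eq_self v hev

end TestObject

section Linearization

variable {A : Type u} [Category.{v} A]

theorem hasChainConditions_stableFamilies_of_testObject {k : Type t} [Field k]
    {F : A ⥤ ModuleCat.{w} k} {b : A} [Module.Finite k (F.obj b)]
    (hb : ∀ L L' : stableFamilies F, L.1 b ≤ L'.1 b → L ≤ L') :
    HasChainConditions (stableFamilies F) := by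
  have hmono : StrictMono fun L : stableFamilies F ↦ L.1 b := fun L L' hlt ↦
    lt_of_le_not_ge (hlt.le b) fun hge ↦ hlt.not_ge (hb L' L hge)
  exact ⟨hmono.wellFoundedLT, hmono.wellFoundedGT⟩

variable {S : Type t} [Ring S] {D : A ⥤ ModuleCat.{w} S}

theorem supported_le_supported_iff {α k : Type*} [Semiring k] [Nontrivial k] {s s' : Set α} :
    Finsupp.supported k k s ≤ Finsupp.supported k k s' ↔ s ⊆ s' := by
  classical
  refine ⟨fun h a ha ↦ ?_, Finsupp.supported_mono⟩
  have hmem := (Finsupp.mem_supported k _).1 (h (Finsupp.single_mem_supported k (1 : k) ha))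
  exact hmem (by simp)

/-- The formal linear combinations of elements of a stable family. -/
noncomputable def supportedFamily (k : Type w) [CommRing k] (N : stableFamilies D) :
    stableFamilies (linearization D k) :=
  ⟨fun y ↦ Finsupp.supported k k (N.1 y : Set (D.obj y)), fun _ _ f ↦
    le_trans (Finsupp.supported_mono fun _ hm ↦ N.2 f hm)
      (Finsupp.supported_comap_lmapDomain k k (D.map f) _)⟩

theorem strictMono_supportedFamily {k : Type w} [CommRing k] [Nontrivial k] :
    StrictMono (supportedFamily (D := D) k) :=
  strictMono_of_le_iff_le fun _ _ ↦ forall_congr' fun _ ↦ supported_le_supported_iff.symm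

end Linearization

section FunctorCat

variable {A : Type u} [Category.{v} A]

instance {S : Type t} [Ring S] : IsSubquotientClosed (𝟭 (A ⥤ ModuleCat.{w} S)) where
  full := inferInstance
  faithful := inferInstance
  sub {_ G} _ _ := ⟨G, ⟨Iso.refl _⟩⟩
  quot {_ G} _ _ := ⟨G, ⟨Iso.refl _⟩⟩

end FunctorCat

section Rep

variable {A : Type u} [Category.{v} A] [Preadditive A]

/-- Additive functors to abelian groups, viewed as functors to `ℤ`-modules. -/
def repToModule : Rep.{w} A ⥤ (A ⥤ ModuleCat.{w} ℤ) where
  obj F :=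
    { obj y := ModuleCat.of ℤ (F.obj.obj y)
      map f := ModuleCat.ofHom (F.obj.map f).hom.toIntLinearMap
      map_id y := by ext m; simp
      map_comp f g := by ext m; simp }
  map φ :=
    { app y := ModuleCat.ofHom (φ.hom.app y).hom.toIntLinearMap
      naturality y z f := by
        ext m
        exact NatTrans.naturality_apply φ.hom f m }

instance (F : Rep.{w} A) : (repToModule.obj F).Additive where
  map_add {y z f g} := by
    ext m
    exact ConcreteCategory.congr_hom (F.obj.map_add (f := f) (g := g)) m

theorem essImage_repToModule (G : A ⥤ ModuleCat.{w} ℤ) [G.Additive] :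
    repToModule.essImage G :=
  ⟨AdditiveFunctor.of (G ⋙ forget₂ (ModuleCat ℤ) AddCommGrpCat), ⟨NatIso.ofComponents
    (fun y ↦ LinearEquiv.toModuleIso (AddEquiv.refl (G.obj y)).toIntLinearEquiv)
    fun f ↦ by ext m; rfl⟩⟩

instance : IsSubquotientClosed (repToModule.{w} (A := A)) where
  full := ⟨fun ψ ↦ ⟨⟨
    { app y := AddCommGrpCat.ofHom (ψ.app y).hom.toAddMonoidHom
      naturality y z f := by
        ext m
        exact NatTrans.naturality_apply ψ f m }⟩, rfl⟩⟩
  faithful := ⟨fun h ↦ by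
    ext y m
    exact congrArg (fun χ ↦ χ.app y m) h⟩
  sub {X G} i _ := by
    have : G.Additive := ⟨fun {y z f g} ↦ by
      rw [← cancel_mono (i.app z)]
      simp only [Preadditive.add_comp, NatTrans.naturality, Functor.map_add, Preadditive.comp_add]⟩
    exact essImage_repToModule G
  quot {X G} p _ := by
    have : G.Additive := ⟨fun {y z f g} ↦ by
      rw [← cancel_epi (p.app y)]
      simp only [Preadditive.comp_add, ← NatTrans.naturality, Functor.map_add,
        Preadditive.add_comp]⟩
    exact essImage_repToModule G

end Rep

section Corepresentable

variable {A : Type u} [Category.{v} A] [Preadditive A] [LocallySmall.{w} A]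

/-- The additive functor `A(x, -)`, with values in the universe `w`. -/
noncomputable def homRep (x : A) : Rep.{w} A :=
  AdditiveFunctor.of (ShrinkHoms.functor A ⋙
    preadditiveCoyoneda.obj (.op (ShrinkHoms.toShrinkHoms x)))

/-- The elements of `A(x, -)` are the morphisms out of `x`. -/
noncomputable def homRepEquiv (x y : A) : (x ⟶ y) ≃ₗ[ℤ] (repToModule.obj (homRep.{w} x)).obj y :=
  AddEquiv.toIntLinearEquiv
    { equivShrink (x ⟶ y) with map_add' _ _ := (ShrinkHoms.functor A).map_add }

theorem map_homRepEquiv {x y z : A} (f : x ⟶ y) (g : y ⟶ z) :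
    (repToModule.obj (homRep.{w} x)).map g (homRepEquiv x y f) = homRepEquiv x z (f ≫ g) :=
  ((ShrinkHoms.functor A).map_comp f g).symm

instance (x y : A) [Finite (x ⟶ y)] : Finite ((repToModule.obj (homRep.{w} x)).obj y) :=
  Finite.of_equiv _ (homRepEquiv x y).toEquiv

/-- The morphism out of `A(x, -)` determined by the image of the identity of `x`. -/
noncomputable def homRepDesc {x : A} {D : A ⥤ ModuleCat.{w} ℤ} [D.Additive] (η : D.obj x) :
    repToModule.obj (homRep.{w} x) ⟶ D where
  app y := ModuleCat.ofHom (evalAt D η y ∘ₗ (homRepEquiv x y).symm.toLinearMap)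
  naturality y z g := by
    ext a
    obtain ⟨f, rfl⟩ := (homRepEquiv x y).surjective a
    change evalAt D η z ((homRepEquiv x z).symm ((repToModule.obj (homRep x)).map g _)) =
      D.map g (evalAt D η y ((homRepEquiv x y).symm _))
    simp [map_homRepEquiv, evalAt]

theorem homRepDesc_app {x y : A} {D : A ⥤ ModuleCat.{w} ℤ} [D.Additive] (η : D.obj x)
    (f : x ⟶ y) : (homRepDesc η).app y (homRepEquiv x y f) = D.map f η :=
  congrArg (evalAt D η y) ((homRepEquiv x y).symm_apply_apply f)

theorem app_homRepEquiv {x y : A} {D : A ⥤ ModuleCat.{w} ℤ}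
    (φ : repToModule.obj (homRep.{w} x) ⟶ D) (f : x ⟶ y) :
    φ.app y (homRepEquiv x y f) = D.map f (φ.app x (homRepEquiv x x (𝟙 x))) := by
  rw [← NatTrans.naturality_apply, map_homRepEquiv, Category.id_comp]

/-- The Yoneda lemma for additive functors. -/
noncomputable def homRepCorepresentableBy (x : A) :
    (repToModule.{w} ⋙ (evaluation A _).obj x ⋙ forget _).CorepresentableBy (homRep.{w} x) where
  homEquiv {F} :=
    { toFun φ := (repToModule.map φ).app x (homRepEquiv x x (𝟙 x))
      invFun η := repToModule.preimage (homRepDesc η)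
      left_inv φ := repToModule.map_injective <| by
        rw [Functor.map_preimage]
        ext y a
        obtain ⟨f, rfl⟩ := (homRepEquiv x y).surjective a
        exact (homRepDesc_app _ f).trans (app_homRepEquiv _ f).symm
      right_inv η := by
        dsimp only
        rw [Functor.map_preimage]
        exact (homRepDesc_app (D := repToModule.obj F) (x := x) η (𝟙 x)).trans (by simp) }
  homEquiv_comp g f := by simp

/-- The morphism out of the linearization of `A(x, -)` determined by the image of the identity of
`x`. -/
noncomputable def linearizationDesc {k : Type w} [CommRing k] {x : A} {F : A ⥤ ModuleCat.{w} k}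
    (η : F.obj x) : linearization (repToModule.obj (homRep.{w} x)) k ⟶ F where
  app y := ModuleCat.freeDesc (↾ fun a ↦ F.map ((homRepEquiv x y).symm a) η)
  naturality y z g := by
    refine ModuleCat.free_hom_ext fun a ↦ ?_
    obtain ⟨f, rfl⟩ := (homRepEquiv x y).surjective a
    rw [ConcreteCategory.comp_apply, linearization_map_freeMk, map_homRepEquiv]
    simp

theorem linearizationDesc_app {k : Type w} [CommRing k] {x y : A} {F : A ⥤ ModuleCat.{w} k}
    (η : F.obj x) (f : x ⟶ y) :
    (linearizationDesc η).app y (ModuleCat.freeMk (homRepEquiv x y f)) = F.map f η :=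
  (ModuleCat.freeDesc_apply _ _).trans
    (congrArg (F.map · η) ((homRepEquiv x y).symm_apply_apply f))

theorem app_freeMk_homRepEquiv {k : Type w} [CommRing k] {x y : A} {F : A ⥤ ModuleCat.{w} k}
    (φ : linearization (repToModule.obj (homRep.{w} x)) k ⟶ F) (f : x ⟶ y) :
    φ.app y (ModuleCat.freeMk (homRepEquiv x y f)) =
      F.map f (φ.app x (ModuleCat.freeMk (homRepEquiv x x (𝟙 x)))) := by
  rw [← NatTrans.naturality_apply, linearization_map_freeMk, map_homRepEquiv, Category.id_comp]

/-- The Yoneda lemma for functors to modules. -/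
noncomputable def linearizationCorepresentableBy (k : Type w) [CommRing k] (x : A) :
    (𝟭 (A ⥤ ModuleCat.{w} k) ⋙ (evaluation A _).obj x ⋙ forget _).CorepresentableBy
      (linearization (repToModule.obj (homRep.{w} x)) k) where
  homEquiv {F} :=
    { toFun φ := φ.app x (ModuleCat.freeMk (homRepEquiv x x (𝟙 x)))
      invFun η := linearizationDesc η
      left_inv φ := by
        ext y : 2
        refine ModuleCat.free_hom_ext fun a ↦ ?_
        obtain ⟨f, rfl⟩ := (homRepEquiv x y).surjective a
        exact (linearizationDesc_app _ f).trans (app_freeMk_homRepEquiv φ f).symm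
      right_inv η := (linearizationDesc_app (F := F) (x := x) η (𝟙 x)).trans (by simp) }
  homEquiv_comp g f := by simp

end Corepresentable

section KTrivial

variable {A : Type u} [Category.{v} A]

theorem IsKTrivial.locallySmall [Preadditive A] {k : Type w} [Field k] (hA : IsKTrivial A k) :
    LocallySmall.{w} A where
  hom_small x y := have := (hA x y).1; inferInstance

variable [Preadditive A] [LocallySmall.{w} A] {k : Type w} [Field k]

theorem isLocallyFinite_rep_iff : IsLocallyFinite (Rep.{w} A) ↔
    ∀ x : A, HasChainConditions (stableFamilies (repToModule.obj (homRep.{w} x))) :=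
  isLocallyFinite_iff homRepCorepresentableBy

theorem isLocallyFinite_functorCat_iff : IsLocallyFinite (FunctorCat A k) ↔
    ∀ x : A, HasChainConditions
      (stableFamilies (linearization (repToModule.obj (homRep.{w} x)) k)) :=
  isLocallyFinite_iff (linearizationCorepresentableBy k)

theorem isLocallyFinite_rep_of_functorCat (h : IsLocallyFinite (FunctorCat A k)) :
    IsLocallyFinite (Rep.{w} A) :=
  isLocallyFinite_rep_iff.2 fun x ↦
    (isLocallyFinite_functorCat_iff.1 h x).of_strictMono strictMono_supportedFamily

theorem isLocallyFinite_functorCat_of_exists_mem_through [HasFiniteBiproducts A]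
    (hA : IsKTrivial A k) (h : ∀ x : A, ∃ t, ∀ y (a : (repToModule.obj (homRep.{w} x)).obj y),
      ∃ e ∈ through t y y, (repToModule.obj (homRep.{w} x)).map e a = a) :
    IsLocallyFinite (FunctorCat A k) := by
  refine isLocallyFinite_functorCat_iff.2 fun x ↦ ?_
  obtain ⟨t, ht⟩ := h x
  have : Finite (End t) := (hA t t).1
  have := (hA x t).1
  obtain ⟨b, hb⟩ := exists_testObject (hA t t).2 ht
  have := (hA x b).1
  have : Module.Finite k ((linearization (repToModule.obj (homRep.{w} x)) k).obj b) :=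
    inferInstanceAs (Module.Finite k ((repToModule.obj (homRep.{w} x)).obj b →₀ k))
  exact hasChainConditions_stableFamilies_of_testObject hb

theorem isLocallyFinite_functorCat_of_rep [HasFiniteBiproducts A] (hA : IsKTrivial A k)
    (h : IsLocallyFinite (Rep.{w} A)) : IsLocallyFinite (FunctorCat A k) := by
  have := hasBinaryBiproducts_of_finite_biproducts A
  refine isLocallyFinite_functorCat_of_exists_mem_through hA fun x ↦ ?_
  have : Nonempty A := ⟨x⟩
  exact exists_forall_mem_through_map_eq _ (isLocallyFinite_rep_iff.1 h x)

end KTrivial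

section ProjectiveModules

variable (R : Type t) [Ring R]

instance : (isFGProjective R).IsClosedUnderFiniteProducts where
  isClosedUnderLimitsOfShape J _ := ⟨fun X ⟨p⟩ ↦ by
    let M (j : J) : ModuleCat.{t} R := p.diag.obj ⟨j⟩
    have (j : J) : Module.Finite R (M j) := (p.prop_diag_obj ⟨j⟩).1
    have (j : J) : Module.Projective R (M j) := (p.prop_diag_obj ⟨j⟩).2
    have := Fintype.ofFinite J
    let e : (∀ j, M j) ≃ₗ[R] X := (IsLimit.conePointsIsoOfNatIso
      (ModuleCat.HasLimit.productLimitCone M).isLimit p.isLimit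
      Discrete.natIsoFunctor.symm).toLinearEquiv
    have : Module.Projective R (∀ j, M j) := by
      classical
      exact .of_equiv (DFinsupp.linearEquivFunOnFintype (R := R) (M := fun j ↦ M j))
    exact ⟨.equiv e, .of_equiv e⟩⟩

instance : HasFiniteBiproducts (ProjCat R) := .of_hasFiniteProducts

/-- The regular module, as a finitely generated projective module. -/
def regularModule : ProjCat R :=
  ⟨ModuleCat.of R R, inferInstanceAs (Module.Finite R R), inferInstanceAs (Module.Projective R R)⟩

theorem id_mem_through_regularModule (y : ProjCat R) : 𝟙 y ∈ through (regularModule R) y y := by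
  have := y.property.1
  have := y.property.2
  obtain ⟨n, p, s, -, -, hs⟩ := Module.Finite.exists_comp_eq_id_of_projective R y.obj
  let f (i : Fin n) : y ⟶ regularModule R :=
    ObjectProperty.homMk (ModuleCat.ofHom (LinearMap.proj i ∘ₗ s))
  let g (i : Fin n) : regularModule R ⟶ y :=
    ObjectProperty.homMk (ModuleCat.ofHom (p ∘ₗ LinearMap.single R (fun _ ↦ R) i))
  have hfg : ∑ i, f i ≫ g i = 𝟙 y := by
    refine (isFGProjective R).ι.map_injective ?_
    rw [Functor.map_sum]
    ext m
    rw [ModuleCat.hom_sum, LinearMap.sum_apply]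
    change ∑ i, p (Pi.single i (s m i)) = m
    rw [← map_sum, Finset.univ_sum_single]
    exact LinearMap.congr_fun hs m
  exact hfg ▸ sum_mem fun i _ ↦ Submodule.subset_span ⟨(f i, g i), rfl⟩

theorem isLocallyFinite_functorCat_projCat {k : Type w} [Field k] (hR : IsKTrivialRing R k) :
    IsLocallyFinite (FunctorCat (ProjCat R) k) := by
  have hA := (isKTrivialRing_iff R k).1 hR
  have := hA.locallySmall
  exact isLocallyFinite_functorCat_of_exists_mem_through hA fun x ↦
    ⟨regularModule R, fun y a ↦ ⟨𝟙 y, id_mem_through_regularModule R y, by simp⟩⟩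

end ProjectiveModules

end GenericRep

theorem mainTheorem6_general (k : Type w) [Field k] :
    (∀ (A : Type u) [Category.{v} A] [Preadditive A] [HasFiniteBiproducts A],
        GenericRep.IsKTrivial A k →
        (GenericRep.IsLocallyFinite (GenericRep.FunctorCat A k) ↔
          GenericRep.IsLocallyFinite (GenericRep.Rep.{w} A))) ∧
    (∀ (R : Type t) [Ring R], GenericRep.IsKTrivialRing R k →
        GenericRep.IsLocallyFinite (GenericRep.FunctorCat (GenericRep.ProjCat R) k)) := by
  refine ⟨fun A _ _ _ hA ↦ ?_, fun R _ hR ↦ GenericRep.isLocallyFinite_functorCat_projCat R hR⟩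
  have := hA.locallySmall
  exact ⟨GenericRep.isLocallyFinite_rep_of_functorCat,
    GenericRep.isLocallyFinite_functorCat_of_rep hA⟩

theorem mainTheorem6 (k : Type w) [Field k] :
    (∀ (A : Type u) [Category.{v} A] [Preadditive A] [HasFiniteBiproducts A]
        [EssentiallySmall.{w} A], GenericRep.IsKTrivial A k →
        (GenericRep.IsLocallyFinite (GenericRep.FunctorCat A k) ↔
          GenericRep.IsLocallyFinite (GenericRep.Rep.{w} A))) ∧
    (∀ (R : Type t) [Ring R], GenericRep.IsKTrivialRing R k →
        GenericRep.IsLocallyFinite (GenericRep.FunctorCat (GenericRep.ProjCat R) k)) := by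
  have general := mainTheorem6_general.{w, v, u, t} k
  exact ⟨fun A _ _ _ _ hA ↦ general.1 A hA, general.2⟩
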